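/- All graphs are finite and simple. A graph $G=(V,E)$ is 3-balanced if there is a coloring $\ell:V\to\mathbb{Z}_3$ (a 3-balanced coloring) such that for every vertex $v$ the open neighborhood $N(v)$ contains equally many vertices of each of the three colors. Define the following graphs. - $D$ is the 4-cycle $0123$ with the chord $13$. - $EB$ consists of two disjoint triangles $012$ and $345$ and a further vertex $6$ adjacent to $0$ and $3$. - $F_1$ is the 4-cycle $0123$ together with the path $2,4,5,6,0$. - $F_2$ is the 8-cycle $01234567$ with the chords $13$ and $04$. - $F_3$ is the 7-cycle $0123456$ with two further vertices $7,8$ and the edges $07,\ 78,\ 28,\ 58$. - $F_4$ is the 5-cycle $01234$ with three further vertices $5,6,7$ and the edges $56,\ 57,\ 61,\ 63,\ 74$. - Tietze's graph is the Petersen graph with one vertex replaced by a triangle, i.e. the graph on $\{0,\dots,11\}$ consisting of the 9-cycle $0,1,\dots,8$, the triangle $9,10,11$ and the edges $\{0,9\},\{3,10\},\{6,11\},\{1,5\},\{2,7\},\{4,8\}$. For $c=[c_0,\dots,c_{11}]$ let $L(c)$ be the graph on $\mathbb{Z}_{12}$ with the edges $\{i,i+1\}$ and $\{i,i+c_i\}$,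 $i\in\mathbb{Z}_{12}$. **Theorem.** Up to isomorphism there are exactly 85 connected cubic graphs on 12 vertices, and exactly 17 of them are 3-balanced. (a) The 17 graphs $L(c)$ below are connected, cubic and pairwise non-isomorphic; every connected cubic 3-balanced graph on 12 vertices is isomorphic to one of them; and in each case the displayed vector $(\ell(0),\dots,\ell(11))$ is a 3-balanced coloring of $L(c)$: 1. $[9, 2, 3, 10, 3, 9, 4, 9, 3, 3, 8, 9]$, $(0, 0, 1, 2, 2, 1, 0, 0, 1, 1, 2, 2)$; 2. $[2, 3, 10, 8, 9, 3, 3, 3, 9, 9, 9, 4]$, $(0, 1, 2, 2, 1, 0, 0, 1, 2, 2, 1, 0)$; 3. $[8, 4, 2, 3, 10, 8, 9, 3, 4, 2, 9, 10]$, $(0, 1, 1, 0, 2, 2, 0, 1, 2, 2, 1, 0)$; 4. $[2, 6, 10, 2, 6, 10, 2, 6, 10, 2, 6, 10]$, $(0, 1, 2, 2, 1, 0, 0, 1, 2, 2, 1, 0)$; 5. $[6, 4, 2, 6, 10, 8, 6, 4, 2, 6, 10, 8]$, $(0, 1, 1, 0, 2, 2, 0, 1, 1, 0, 2, 2)$;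 6. $[9, 9, 2, 3, 10, 2, 9, 10, 3, 3, 3, 9]$, $(0, 1, 1, 2, 0, 0, 2, 1, 1, 0, 2, 2)$; 7. $[5, 2, 8, 10, 5, 7, 2, 4, 10, 7, 4, 8]$, $(0, 0, 1, 2, 2, 1, 1, 2, 0, 0, 1, 2)$; 8. $[4, 9, 7, 2, 8, 10, 2, 4, 10, 5, 3, 8]$, $(0, 1, 2, 2, 0, 1, 1, 2, 0, 0, 1, 2)$; 9. $[8, 2, 5, 10, 7, 5, 3, 7, 4, 9, 7, 5]$, $(0, 0, 1, 2, 2, 0, 0, 1, 2, 2, 1, 1)$; 10. $[3, 6, 3, 9, 6, 9, 3, 6, 3, 9, 6, 9]$, $(0, 1, 1, 2, 2, 0, 0, 2, 2, 1, 1, 0)$; 11. $[3, 6, 6, 9, 7, 5, 3, 6, 6, 9, 7, 5]$, $(0, 1, 1, 0, 2, 1, 0, 2, 2, 0, 1, 2)$; 12. $[4, 8, 9, 3, 8, 3, 9, 3, 9, 4, 9, 3]$, $(0, 0, 1, 2, 2, 1, 0, 0, 1, 2, 2, 1)$; 13. $[5, 6, 7, 5, 6, 7, 5, 6, 7, 5,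 6, 7]$, $(0, 1, 2, 0, 1, 2, 2, 1, 0, 2, 1, 0)$; 14. $[10, 2, 9, 10, 2, 3, 10, 2, 9, 10, 2, 3]$, $(0, 0, 1, 2, 2, 1, 0, 0, 1, 2, 2, 1)$; 15. $[9, 3, 3, 4, 9, 9, 4, 8, 3, 3, 8, 9]$, $(0, 0, 1, 2, 2, 1, 0, 0, 1, 1, 2, 2)$; 16. $[3, 7, 5, 9, 7, 5, 3, 7, 5, 9, 7, 5]$, $(0, 0, 1, 2, 2, 0, 0, 1, 2, 2, 1, 1)$; 17. $[9, 9, 3, 3, 3, 9, 9, 9, 3, 3, 3, 9]$, $(0, 0, 1, 2, 0, 1, 2, 0, 1, 1, 2, 2)$. (b) A connected cubic graph on 12 vertices fails to be 3-balanced if and only if it has a bridge, or contains one of $D, EB, F_1, F_2, F_3, F_4$ as a (not necessarily induced) subgraph, or is isomorphic to Tietze's graph. Tietze's graph is a connected cubic graph that has no bridge, contains none of these six subgraphs, and has chromatic index 4. (c) To each of the 68 isomorphism classes of connected cubic graphs on 12 vertices that are not 3-balanced one can assign one of the obstructions in (b) to which it is subject, in such a way that "bridge" is assigned to 4 classes,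 $D$ to 18, $EB$ to 13, $F_1$ to 24, $F_2$ to 1, $F_3$ to 5, $F_4$ to 2, and "Tietze's graph" to 1. -/

import Mathlib

/-- A cubic graph: a finite simple graph all of whose vertices have degree 3. -/
def IsCubic {V : Type*} [Fintype V] (G : SimpleGraph V) : Prop := by
  classical exact G.IsRegularOfDegree 3

/-- A vertex coloring `ℓ` with colors in `ZMod 3` is neighborhood 3-balanced if every open
neighborhood contains equally many vertices of each of the three colors. -/
def IsBalancedColoring {V : Type*} [Fintype V] (G : SimpleGraph V) (ℓ : V → ZMod 3) : Prop :=
  ∀ v : V, ∀ i j : ZMod 3,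
    (G.neighborSet v ∩ ℓ ⁻¹' {i}).ncard = (G.neighborSet v ∩ ℓ ⁻¹' {j}).ncard

/-- A graph is 3-balanced if it has a neighborhood 3-balanced coloring. -/
def IsThreeBalanced {V : Type*} [Fintype V] (G : SimpleGraph V) : Prop :=
  ∃ ℓ : V → ZMod 3, IsBalancedColoring G ℓ

/-- The chromatic index: the least number of colors of a proper edge coloring. -/
noncomputable def chromaticIndex {V : Type*} (G : SimpleGraph V) : ℕ∞ :=
  G.lineGraph.chromaticNumber

/-- Some edge of `G` is a bridge. -/
def HasBridge {V : Type*} (G : SimpleGraph V) : Prop :=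
  ∃ e ∈ G.edgeSet, G.IsBridge e

/-- The diamond `D`: a 4-cycle with one chord. -/
def diamond : SimpleGraph (Fin 4) :=
  SimpleGraph.fromEdgeSet
    {s(0, 1), s(1, 2), s(2, 3), s(3, 0), s(1, 3)}

/-- The extended bowtie `EB`: two disjoint triangles `0 1 2` and `3 4 5`, and a further vertex `6`
adjacent to one vertex of each. -/
def extendedBowtie : SimpleGraph (Fin 7) :=
  SimpleGraph.fromEdgeSet
    {s(0, 1), s(0, 2), s(1, 2), s(3, 4), s(3, 5), s(4, 5), s(0, 6), s(6, 3)}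

/-- The graph `F₁`: a 4-cycle `0 1 2 3`, two opposite vertices of which are also joined by a path
`2 4 5 6 0` of length 4. -/
def graphF1 : SimpleGraph (Fin 7) :=
  SimpleGraph.fromEdgeSet
    {s(0, 1), s(1, 2), s(2, 3), s(3, 0), s(2, 4), s(4, 5), s(5, 6), s(6, 0)}

/-- The graph `F₂`: an 8-cycle with the chords `1 3` and `0 4`. -/
def graphF2 : SimpleGraph (Fin 8) :=
  SimpleGraph.fromEdgeSet
    {s(0, 1), s(1, 2), s(2, 3), s(3, 4), s(4, 5), s(5, 6), s(6, 7), s(7, 0), s(1, 3), s(0, 4)}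

/-- The graph `F₃`: a 7-cycle `0 … 6` and two further adjacent vertices `7`, `8`, with `7` adjacent
to `0`, and `8` adjacent to `2` and `5`. -/
def graphF3 : SimpleGraph (Fin 9) :=
  SimpleGraph.fromEdgeSet
    {s(0, 1), s(1, 2), s(2, 3), s(3, 4), s(4, 5), s(5, 6), s(6, 0), s(0, 7), s(7, 8), s(2, 8), s(5, 8)}

/-- The graph `F₄`: a 5-cycle `0 … 4` and a path `6 5 7`, with `6` adjacent to `1` and `3`, and `7`
adjacent to `4`. -/
def graphF4 : SimpleGraph (Fin 8) :=
  SimpleGraph.fromEdgeSet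
    {s(0, 1), s(1, 2), s(2, 3), s(3, 4), s(4, 0), s(5, 6), s(5, 7), s(6, 1), s(6, 3), s(7, 4)}

/-- Tietze's graph: the Petersen graph with one vertex replaced by a triangle (here `9 10 11`). -/
def tietzeGraph : SimpleGraph (Fin 12) :=
  SimpleGraph.fromEdgeSet
    {s(0, 1), s(1, 2), s(2, 3), s(3, 4), s(4, 5), s(5, 6), s(6, 7), s(7, 8), s(8, 0),
     s(0, 9), s(3, 10), s(6, 11), s(9, 10), s(10, 11), s(11, 9),
     s(1, 5), s(2, 7), s(4, 8)}

/-- The reasons for which a connected cubic graph on 12 vertices can fail to be 3-balanced. -/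
inductive Obstruction
  | bridge
  | diamond
  | extendedBowtie
  | F1
  | F2
  | F3
  | F4
  | tietze

/-- The graph `G` is subject to the given obstruction: it has a bridge, it contains the given
graph as a (not necessarily induced) subgraph, or it is isomorphic to Tietze's graph. -/
def Obstruction.Holds {V : Type*} (G : SimpleGraph V) : Obstruction → Prop
  | .bridge => HasBridge G
  | .diamond => SimpleGraph.IsContained _root_.diamond G
  | .extendedBowtie => SimpleGraph.IsContained _root_.extendedBowtie G
  | .F1 => SimpleGraph.IsContained graphF1 G
  | .F2 => SimpleGraph.IsContained graphF2 G
  | .F3 => SimpleGraph.IsContained graphF3 G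
  | .F4 => SimpleGraph.IsContained graphF4 G
  | .tietze => Nonempty (G ≃g tietzeGraph)

/-- The connected cubic graphs with vertex set `Fin 12`. -/
abbrev CubicTwelve : Type :=
  {G : SimpleGraph (Fin 12) // G.Connected ∧ IsCubic G}

/-- Graph isomorphism, as an equivalence relation on the connected cubic graphs. -/
def cubicTwelveSetoid : Setoid CubicTwelve where
  r G H := Nonempty (G.1 ≃g H.1)
  iseqv :=
    ⟨fun _ => ⟨SimpleGraph.Iso.refl⟩, fun ⟨f⟩ => ⟨f.symm⟩, fun ⟨f⟩ ⟨g⟩ => ⟨g.comp f⟩⟩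

/-- Isomorphism classes of connected cubic graphs on 12 vertices. -/
abbrev CubicTwelveClass : Type := Quotient cubicTwelveSetoid

/-- The isomorphism class of a connected cubic graph on 12 vertices. -/
def CubicTwelve.toClass (G : CubicTwelve) : CubicTwelveClass :=
  Quotient.mk cubicTwelveSetoid G

/-- The cubic graph on 12 vertices with a given LCF code: the Hamiltonian cycle `0, 1, …, 11`
together with the chords `{i, i + c i}` (addition modulo 12). -/
def lcfGraph (c : Fin 12 → Fin 12) : SimpleGraph (Fin 12) :=
  SimpleGraph.fromRel fun i j => j = i + 1 ∨ j = i + c i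

/-- LCF codes of the 17 connected cubic 3-balanced graphs on 12 vertices. -/
def balancedCode : Fin 17 → Fin 12 → Fin 12 :=
  ![![9, 2, 3, 10, 3, 9, 4, 9, 3, 3, 8, 9],
    ![2, 3, 10, 8, 9, 3, 3, 3, 9, 9, 9, 4],
    ![8, 4, 2, 3, 10, 8, 9, 3, 4, 2, 9, 10],
    ![2, 6, 10, 2, 6, 10, 2, 6, 10, 2, 6, 10],
    ![6, 4, 2, 6, 10, 8, 6, 4, 2, 6, 10, 8],
    ![9, 9, 2, 3, 10, 2, 9, 10, 3, 3, 3, 9],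
    ![5, 2, 8, 10, 5, 7, 2, 4, 10, 7, 4, 8],
    ![4, 9, 7, 2, 8, 10, 2, 4, 10, 5, 3, 8],
    ![8, 2, 5, 10, 7, 5, 3, 7, 4, 9, 7, 5],
    ![3, 6, 3, 9, 6, 9, 3, 6, 3, 9, 6, 9],
    ![3, 6, 6, 9, 7, 5, 3, 6, 6, 9, 7, 5],
    ![4, 8, 9, 3, 8, 3, 9, 3, 9, 4, 9, 3],
    ![5, 6, 7, 5, 6, 7, 5, 6, 7, 5, 6, 7],
    ![10, 2, 9, 10, 2, 3, 10, 2, 9, 10, 2, 3],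
    ![9, 3, 3, 4, 9, 9, 4, 8, 3, 3, 8, 9],
    ![3, 7, 5, 9, 7, 5, 3, 7, 5, 9, 7, 5],
    ![9, 9, 3, 3, 3, 9, 9, 9, 3, 3, 3, 9]]

/-- The `k`-th graph of the list of 3-balanced graphs. -/
def balancedGraph (k : Fin 17) : SimpleGraph (Fin 12) := lcfGraph (balancedCode k)

/-- An explicit coloring of the `k`-th graph of the list. -/
def listedColoring : Fin 17 → Fin 12 → ZMod 3 :=
  ![![0, 0, 1, 2, 2, 1, 0, 0, 1, 1, 2, 2],
    ![0, 1, 2, 2, 1, 0, 0, 1, 2, 2, 1, 0],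
    ![0, 1, 1, 0, 2, 2, 0, 1, 2, 2, 1, 0],
    ![0, 1, 2, 2, 1, 0, 0, 1, 2, 2, 1, 0],
    ![0, 1, 1, 0, 2, 2, 0, 1, 1, 0, 2, 2],
    ![0, 1, 1, 2, 0, 0, 2, 1, 1, 0, 2, 2],
    ![0, 0, 1, 2, 2, 1, 1, 2, 0, 0, 1, 2],
    ![0, 1, 2, 2, 0, 1, 1, 2, 0, 0, 1, 2],
    ![0, 0, 1, 2, 2, 0, 0, 1, 2, 2, 1, 1],
    ![0, 1, 1, 2, 2, 0, 0, 2, 2, 1, 1, 0],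
    ![0, 1, 1, 0, 2, 1, 0, 2, 2, 0, 1, 2],
    ![0, 0, 1, 2, 2, 1, 0, 0, 1, 2, 2, 1],
    ![0, 1, 2, 0, 1, 2, 2, 1, 0, 2, 1, 0],
    ![0, 0, 1, 2, 2, 1, 0, 0, 1, 2, 2, 1],
    ![0, 0, 1, 2, 2, 1, 0, 0, 1, 1, 2, 2],
    ![0, 0, 1, 2, 2, 0, 0, 1, 2, 2, 1, 1],
    ![0, 0, 1, 2, 0, 1, 2, 0, 1, 1, 2, 2]]

/-! The classification rests on a search whose every step is certified. A level of the search is a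
list of graphs on 12 vertices, all with the same number of edges, such that every connected cubic
graph `G` contains a copy of one of them. The first level is the empty graph. To pass to the next
level, choose in each listed graph a vertex `v` of degree less than 3. Under any copy in `G` the
image of `v` has a further neighbor, so `G` contains a copy of an extension by one edge at `v`
(`exists_containsCopy_candidates`). An extension may be discarded if it contains a copy of a graph
that is kept, or if its non-isolated vertices all have full degree while isolated vertices remain
(`not_connected_of_isSaturated`). The numerical data only prescribe the choices of `v` and the
permutations exhibiting copies, and all of them are verified. After 18 edges 85 cubic graphs remain,
and a cubic graph that contains a cubic graph on the same vertices is isomorphic to it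
(`nonempty_iso_of_containsCopy`). The 85 graphs are pairwise non-isomorphic because `cubicInvariant`
separates them.

In a cubic graph a balanced coloring gives the three neighbors of each vertex three different colors
(`IsBalancedColoring.ne_of_adj`). Such a coloring restricts to every subgraph, so a subgraph without
a 3-coloring that separates neighbors of a common vertex excludes balance
(`not_isThreeBalanced_of_containsCopy`). An exhaustive search finds no such coloring of any
obstruction other than a bridge, Tietze's graph included. For bridges the classification is used:
the 17 representatives with a coloring are checked to be bridgeless, and every other representative
is shown not to be 3-balanced.

The representatives are ordered so that numbers 0 to 16 are literally the listed balanced graphs,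
number 84 is literally Tietze's graph, and the numbers between form blocks with a common
obstruction. The multiplicities in the last claim are the lengths of these blocks. Adjacency
matrices are coded as 144-bit numbers, so that the finite checks become arithmetic. -/

/-! ### Coded graphs and the search procedure -/

/-- Whether the number `n`, read as a 12 × 12 matrix of bits, has a 1 at the position `(i, j)`. -/
def adjBit (n : ℕ) (i j : Fin 12) : Bool :=
  Nat.beq (Nat.land (Nat.shiftRight n (Nat.add (Nat.mul 12 i.val) j.val)) 1) 1

/-- The vertices, as an explicit list. -/
def vertexList : List (Fin 12) :=
  [⟨0, by decide⟩, ⟨1, by decide⟩, ⟨2, by decide⟩, ⟨3, by decide⟩, ⟨4, by decide⟩, ⟨5, by decide⟩,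
    ⟨6, by decide⟩, ⟨7, by decide⟩, ⟨8, by decide⟩, ⟨9, by decide⟩, ⟨10, by decide⟩, ⟨11, by decide⟩]

/-- The adjacency matrix of a graph given by its list of edges, as a number. -/
def edgesCode : List (Fin 12 × Fin 12) → ℕ
  | [] => 0
  | e :: es => edgesCode es ||| (2 ^ (12 * e.1.val + e.2.val) ||| 2 ^ (12 * e.2.val + e.1.val))

/-- A row of an adjacency matrix. -/
def codeRow (n : ℕ) (i : Fin 12) : ℕ := Nat.land (Nat.shiftRight n (Nat.mul 12 i.val)) 4095

/-- The number with its last binary digit 1 replaced by 0. -/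
def clearLowBit (r : ℕ) : ℕ := Nat.land r (Nat.pred r)

/-- Whether `r` has less than three binary digits 1. -/
def hasFewBits (r : ℕ) : Bool := Nat.beq (clearLowBit (clearLowBit r)) 0

/-- The map that is coded by the digits of `p` in base 12. -/
def digitMap (p : ℕ) (i : Fin 12) : Fin 12 :=
  ⟨Nat.mod (Nat.div p (Nat.pow 12 i.val)) 12, Nat.mod_lt _ (by decide)⟩

/-- The set of the values of a map on a list, as a number. -/
def valueSet (f : Fin 12 → Fin 12) : List (Fin 12) → ℕ
  | [] => 0
  | i :: is => valueSet f is ||| 2 ^ (f i).val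

/-- Whether `p` codes a permutation that carries the edges `es` to edges of the graph `n`. -/
def isEmbedding (es : List (Fin 12 × Fin 12)) (n p : ℕ) : Bool :=
  Nat.beq (valueSet (digitMap p) vertexList) 4095 &&
    es.all fun e => adjBit n (digitMap p e.1) (digitMap p e.2)

/-- Whether every vertex has degree 0 or at least 3, and both possibilities occur. -/
def isSaturated (n : ℕ) : Bool :=
  (vertexList.all fun i => Nat.beq (codeRow n i) 0 || !hasFewBits (codeRow n i)) &&
    ((vertexList.any fun i => Nat.beq (codeRow n i) 0) &&
      vertexList.any fun i => !Nat.beq (codeRow n i) 0)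

/-- The possible new neighbors of `v` in a cubic supergraph of the graph `n`, where the isolated
vertex `k` may stand for all isolated vertices. -/
def candidates (n : ℕ) (v k : Fin 12) : List (Fin 12) :=
  vertexList.filter fun w => !Nat.beq w.val v.val && (!adjBit n v w && (hasFewBits (codeRow n w) &&
    -- An isolated `w` is passed over in favor of `k` only if `k` is itself isolated and differs
    -- from `v`. An unsuitable `k` therefore disables the reduction but does no harm.
    (Nat.beq w.val k.val || (!Nat.beq (codeRow n w) 0 ||
      (!Nat.beq (codeRow n k) 0 || Nat.beq k.val v.val)))))

/-- Handles the graphs obtained from `es` by adding an edge from `v` to a vertex in a given list: as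
directed by the digits of `d`, such a graph is added to the list `acc`, or found to have no
connected cubic supergraph, or found to contain a copy of a graph in `acc`. -/
def expand (es : List (Fin 12 × Fin 12)) (v : Fin 12) :
    List (Fin 12) → ℕ → List (List (Fin 12 × Fin 12)) → Option (List (List (Fin 12 × Fin 12)))
  | [], _, acc => some acc
  | w :: ws, d, acc =>
    -- Instructions are read from the low end of `d`. Two bits select the action. An instruction
    -- that names a copy has ten more bits for a position in `acc` and twelve base-12 digits for a
    -- permutation, whence the divisor `4096 * 12 ^ 12`.
    match d % 4 with
    | 0 => expand es v ws (d / 4) (((v, w) :: es) :: acc)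
    | 1 => match isSaturated (edgesCode ((v, w) :: es)) with
      | true => expand es v ws (d / 4) acc
      | false => none
    | _ => match acc.drop (d / 4 % 1024) with
      | [] => none
      | b :: _ => match isEmbedding b (edgesCode ((v, w) :: es)) (d / 4096) with
        | true => expand es v ws (d / (4096 * 12 ^ 12)) acc
        | false => none

/-- Adds an edge to each of the graphs in a list in all possible ways. -/
def nextLevel : List (List (Fin 12 × Fin 12)) → List ℕ → List (List (Fin 12 × Fin 12)) →
    Option (List (List (Fin 12 × Fin 12)))
  | [], _, acc => some acc
  | _ :: _, [], _ => none
  | es :: rest, d :: ds, acc =>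
    -- The two lowest base-12 digits of `d` are the vertex to be extended and the stand-in for the
    -- isolated vertices. Division by 144 removes them.
    match hasFewBits (codeRow (edgesCode es) (digitMap d 0)) with
    | true =>
      match expand es (digitMap d 0)
          (candidates (edgesCode es) (digitMap d 0) (digitMap d 1)) (d / 144) acc with
      | none => none
      | some acc' => nextLevel rest ds acc'
    | false => none

/-- Iterates `nextLevel`. -/
def allLevels : List (List ℕ) → List (List (Fin 12 × Fin 12)) →
    Option (List (List (Fin 12 × Fin 12)))
  | [], L => some L
  | ds :: rest, L => match nextLevel L ds [] with
    | none => none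
    | some L' => allLevels rest L'

/-- The edges of a graph given by its adjacency matrix. -/
def codeEdges (n : ℕ) : List (Fin 12 × Fin 12) :=
  vertexList.flatMap fun i => (vertexList.filter fun j => Nat.blt i.val j.val && adjBit n i j).map
    fun j => (i, j)

/-- Whether the search as directed by `data` and `ds` ends with the graphs `ns`. -/
def isCompleteSearch (data : List (List ℕ)) (ds ns : List ℕ) : Bool :=
  match allLevels data [[]] with
  | none => false
  | some L => match nextLevel L ds (ns.map codeEdges) with
    | none => false
    -- The last level starts from the proposed list as accumulator. Equal lengths mean that nothing
    -- was added to it.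
    | some L' => Nat.beq L'.length (ns.map codeEdges).length

/-! ### What the codes mean -/

theorem adjBit_iff {n : ℕ} {i j : Fin 12} :
    adjBit n i j = true ↔ n.testBit (12 * i.val + j.val) = true := by
  have h : Nat.land (Nat.shiftRight n (Nat.add (Nat.mul 12 i.val) j.val)) 1 =
      (n >>> (12 * i.val + j.val)) % 2 := Nat.and_one_is_mod _
  rw [adjBit, h, Nat.beq_eq, Nat.testBit_eq_decide_div_mod_eq, Nat.shiftRight_eq_div_pow]
  simp

theorem mem_vertexList (i : Fin 12) : i ∈ vertexList := by
  revert i; decide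

theorem adjBit_edgesCode {es : List (Fin 12 × Fin 12)} {i j : Fin 12} :
    adjBit (edgesCode es) i j = true ↔ (i, j) ∈ es ∨ (j, i) ∈ es := by
  rw [adjBit_iff]
  induction es with
  | nil => simp [edgesCode]
  | cons e es ih =>
    obtain ⟨a, b⟩ := e
    have h1 : 12 * a.val + b.val = 12 * i.val + j.val ↔ i = a ∧ j = b := by omega
    have h2 : 12 * b.val + a.val = 12 * i.val + j.val ↔ j = a ∧ i = b := by omega
    simp only [edgesCode, Nat.testBit_or, Bool.or_eq_true, ih, Nat.testBit_two_pow,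
      decide_eq_true_eq, h1, h2, List.mem_cons, Prod.mk.injEq]
    tauto

theorem adjBit_edgesCode_comm (es : List (Fin 12 × Fin 12)) (i j : Fin 12) :
    adjBit (edgesCode es) i j = adjBit (edgesCode es) j i := by
  rw [Bool.eq_iff_iff, adjBit_edgesCode, adjBit_edgesCode, or_comm]

theorem codeRow_lt (n : ℕ) (i : Fin 12) : codeRow n i < 4096 :=
  lt_of_le_of_lt (Nat.and_le_right (n := n >>> (12 * i.val)) (m := 4095)) (by norm_num)

theorem testBit_codeRow (n : ℕ) (i j : Fin 12) : (codeRow n i).testBit j.val = adjBit n i j := by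
  have h : codeRow n i = (n >>> (12 * i.val)) % 2 ^ 12 := Nat.and_two_pow_sub_one_eq_mod _ 12
  rw [Bool.eq_iff_iff, adjBit_iff, h, Nat.testBit_mod_two_pow, Nat.testBit_shiftRight]
  simp

theorem codeRow_eq_zero_iff {n : ℕ} {i : Fin 12} : codeRow n i = 0 ↔ ∀ j, adjBit n i j = false := by
  simp only [← testBit_codeRow]
  constructor
  · intro h; simp [h]
  · intro h
    refine Nat.eq_of_testBit_eq fun j => ?_
    rw [Nat.zero_testBit]
    by_cases hj : j < 12
    · exact h ⟨j, hj⟩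
    · exact Nat.testBit_lt_two_pow ((codeRow_lt n i).trans_le
        (Nat.pow_le_pow_right (n := 2) (by norm_num) (not_lt.1 hj)))

theorem hasFewBits_eq_countP (r : ℕ) (hr : r < 4096) :
    hasFewBits r = Nat.blt (vertexList.countP fun j => adjBit r 0 j) 3 := by
  -- All 4096 possible rows are tested, with the row split into two base-64 digits.
  have h : ∀ a < 64, ∀ b < 64, hasFewBits (64 * a + b) =
      Nat.blt (vertexList.countP fun j => adjBit (64 * a + b) 0 j) 3 := by decide +kernel
  have := h (r / 64) (by omega) (r % 64) (by omega)
  rwa [Nat.div_add_mod] at this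

theorem countP_vertexList (p : Fin 12 → Bool) :
    vertexList.countP p = (Finset.univ.filter fun j => p j = true).card := by
  rw [Finset.card_filter, Fin.sum_univ_def]
  have : List.finRange 12 = vertexList := by decide
  rw [this, List.countP_eq_length_filter]
  generalize vertexList = l
  induction l with
  | nil => rfl
  | cons a l ih => by_cases ha : p a <;> simp_all [add_comm]

theorem hasFewBits_codeRow {n : ℕ} {i : Fin 12} : hasFewBits (codeRow n i) = true ↔
    (Finset.univ.filter fun j => adjBit n i j = true).card < 3 := by
  have h : ∀ j, adjBit (codeRow n i) 0 j = adjBit n i j := fun j => by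
    rw [← testBit_codeRow n i j, Bool.eq_iff_iff, adjBit_iff]; simp
  rw [hasFewBits_eq_countP _ (codeRow_lt n i), ← countP_vertexList]
  simp only [h]
  exact Nat.blt_eq.to_iff

theorem exists_of_testBit_valueSet {f : Fin 12 → Fin 12} {is : List (Fin 12)} {x : ℕ}
    (h : (valueSet f is).testBit x = true) : ∃ i, (f i).val = x := by
  induction is with
  | nil => simp [valueSet] at h
  | cons i is ih =>
    rw [valueSet, Nat.testBit_or, Bool.or_eq_true] at h
    refine h.elim ih fun h => ⟨i, ?_⟩
    rwa [Nat.testBit_two_pow, decide_eq_true_eq] at h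

theorem injective_of_valueSet_eq {f : Fin 12 → Fin 12} {is : List (Fin 12)}
    (h : valueSet f is = 4095) : Function.Injective f := by
  refine Finite.injective_iff_surjective.2 fun x => ?_
  obtain ⟨i, hi⟩ := exists_of_testBit_valueSet (f := f) (is := is) (x := x.val)
    (by rw [h]; revert x; decide)
  exact ⟨i, Fin.ext hi⟩

/-! ### Copies in cubic graphs and extension by one edge -/

/-- The graph `G` contains a copy of the graph with edges `es`. -/
def ContainsCopy (G : SimpleGraph (Fin 12)) (es : List (Fin 12 × Fin 12)) : Prop :=
  ∃ f : Fin 12 → Fin 12, Function.Injective f ∧ ∀ e ∈ es, G.Adj (f e.1) (f e.2)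

theorem adj_of_adjBit {G : SimpleGraph (Fin 12)} {es : List (Fin 12 × Fin 12)}
    {f : Fin 12 → Fin 12} (hf : ∀ e ∈ es, G.Adj (f e.1) (f e.2)) {i j : Fin 12}
    (h : adjBit (edgesCode es) i j = true) : G.Adj (f i) (f j) :=
  (adjBit_edgesCode.1 h).elim (fun h => hf _ h) fun h => (hf _ h).symm

theorem ContainsCopy.of_isEmbedding {G : SimpleGraph (Fin 12)} {b es : List (Fin 12 × Fin 12)}
    {p : ℕ} (h : isEmbedding b (edgesCode es) p = true) (hG : ContainsCopy G es) :
    ContainsCopy G b := by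
  obtain ⟨f, hf, hadj⟩ := hG
  rw [isEmbedding, Bool.and_eq_true, Nat.beq_eq, List.all_eq_true] at h
  exact ⟨f ∘ digitMap p, hf.comp (injective_of_valueSet_eq h.1),
    fun e he => adj_of_adjBit hadj (h.2 e he)⟩

theorem IsCubic.card_filter_adj {G : SimpleGraph (Fin 12)} [DecidableRel G.Adj] (hG : IsCubic G)
    (v : Fin 12) : (Finset.univ.filter fun w => G.Adj v w).card = 3 := by
  have h := hG v
  rw [← SimpleGraph.card_neighborFinset_eq_degree] at h
  rw [← h]
  congr 1
  ext w
  simp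

theorem beq_val_eq_false {v w : Fin 12} (h : w ≠ v) : Nat.beq w.val v.val = false := by
  rwa [← Bool.not_eq_true, Nat.beq_eq, ← Fin.ext_iff]

section
variable {G : SimpleGraph (Fin 12)} {es : List (Fin 12 × Fin 12)} {f : Fin 12 → Fin 12}
  (hG : IsCubic G) (hf : Function.Injective f) (hadj : ∀ e ∈ es, G.Adj (f e.1) (f e.2))
include hG hf

/-- Otherwise the three neighbors of `f v` would all be images of the fewer than three neighbors of
`v`. -/
theorem exists_new_neighbor {v : Fin 12} (hv : hasFewBits (codeRow (edgesCode es) v) = true) :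
    ∃ w, G.Adj (f v) (f w) ∧ adjBit (edgesCode es) v w = false := by
  classical
  rw [hasFewBits_codeRow] at hv
  by_contra! hc
  have : (Finset.univ.filter fun w => G.Adj (f v) w) ⊆
      (Finset.univ.filter fun j => adjBit (edgesCode es) v j = true).image f := by
    intro x hx
    obtain ⟨w, rfl⟩ := Finite.injective_iff_surjective.1 hf x
    have := hc w (by simpa using hx)
    simp only [ne_eq, Bool.not_eq_false] at this
    exact Finset.mem_image_of_mem _ (by simpa using this)
  have := (Finset.card_le_card this).trans Finset.card_image_le
  rw [hG.card_filter_adj] at this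
  omega

include hadj

/-- The images of the old neighbors of `w`, together with `f v`, are distinct neighbors of `f w`,
and there are only three of those. -/
theorem hasFewBits_of_new_neighbor {v w : Fin 12} (h : G.Adj (f v) (f w))
    (hvw : adjBit (edgesCode es) v w = false) :
    hasFewBits (codeRow (edgesCode es) w) = true := by
  classical
  rw [hasFewBits_codeRow]
  have hs : insert (f v) ((Finset.univ.filter fun j => adjBit (edgesCode es) w j = true).image f) ⊆
      Finset.univ.filter fun x => G.Adj (f w) x := by
    intro x hx
    rw [Finset.mem_insert, Finset.mem_image] at hx
    rcases hx with rfl | ⟨j, hj, rfl⟩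
    · simpa using h.symm
    · simpa using adj_of_adjBit hadj (by simpa using hj)
  have := Finset.card_le_card hs
  rw [hG.card_filter_adj, Finset.card_insert_of_notMem, Finset.card_image_of_injective _ hf] at this
  · omega
  · rw [Finset.mem_image]
    rintro ⟨j, hj, hjv⟩
    rw [hf hjv, Finset.mem_filter, adjBit_edgesCode_comm, hvw] at hj
    simp at hj

theorem adjBit_of_adj_of_not_hasFewBits {v w : Fin 12} (h : G.Adj (f v) (f w))
    (hv : hasFewBits (codeRow (edgesCode es) v) = false) :
    adjBit (edgesCode es) v w = true := by
  by_contra hc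
  have := hasFewBits_of_new_neighbor hG hf hadj h.symm
    (by rw [adjBit_edgesCode_comm]; simpa using hc)
  simp [hv] at this

/-- The branching step of the search. Isolated vertices are interchangeable, so one of them suffices
as a candidate; replacing one by another changes the copy by a transposition. -/
theorem exists_containsCopy_candidates {v : Fin 12} (k : Fin 12)
    (hv : hasFewBits (codeRow (edgesCode es) v) = true) :
    ∃ w ∈ candidates (edgesCode es) v k, ContainsCopy G ((v, w) :: es) := by
  obtain ⟨w, hw, hvw⟩ := exists_new_neighbor hG hf hv
  have hfew := hasFewBits_of_new_neighbor hG hf hadj hw hvw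
  have hne : w ≠ v := by rintro rfl; exact hw.ne rfl
  have hne' := beq_val_eq_false hne
  -- This is the case in which `w` may have been filtered out. Otherwise `w` is itself a candidate
  -- and `f` need not be changed.
  by_cases hk : codeRow (edgesCode es) w = 0 ∧ codeRow (edgesCode es) k = 0 ∧ k ≠ v
  · obtain ⟨hw0, hk0, hkv⟩ := hk
    have hkv' := beq_val_eq_false hkv
    rw [codeRow_eq_zero_iff] at hw0
    have hk0' := codeRow_eq_zero_iff.1 hk0
    refine ⟨k, ?_, f ∘ Equiv.swap w k, hf.comp (Equiv.injective _), ?_⟩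
    · refine List.mem_filter.2 ⟨mem_vertexList k, ?_⟩
      have h3 : hasFewBits (codeRow (edgesCode es) k) = true := by rw [hk0]; rfl
      rw [h3, hkv', adjBit_edgesCode_comm, hk0']
      simp
    -- Both swapped vertices are isolated, so the transposition fixes the ends of all old edges.
    · have key : ∀ a b : Fin 12, adjBit (edgesCode es) a b = true → a ≠ w ∧ a ≠ k := by
        intro a b hab
        constructor <;> rintro rfl <;> simp_all
      rintro e he
      rcases List.mem_cons.1 he with rfl | he
      · simpa [Equiv.swap_apply_of_ne_of_ne hne.symm hkv.symm] using hw
      · obtain ⟨a, b⟩ := e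
        have h1 := key a b (adjBit_edgesCode.2 (Or.inl he))
        have h2 := key b a (adjBit_edgesCode.2 (Or.inr he))
        simpa [Equiv.swap_apply_of_ne_of_ne, h1, h2] using hadj _ he
  · refine ⟨w, List.mem_filter.2 ⟨mem_vertexList w, ?_⟩, f, hf, ?_⟩
    · rw [hne', hvw, hfew]
      simp only [Bool.not_false, Bool.true_and, Bool.or_eq_true, Bool.not_eq_true',
        ← Bool.not_eq_true]
      rw [Nat.beq_eq, Nat.beq_eq, Nat.beq_eq, Nat.beq_eq, ← Fin.ext_iff, ← Fin.ext_iff]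
      tauto
    · rintro e he
      rcases List.mem_cons.1 he with rfl | he
      exacts [hw, hadj e he]

/-- A non-isolated vertex already has full degree, so all edges of `G` at its image come from `es`
and lead to images of non-isolated vertices. A walk in `G` that starts at one of these never reaches
the image of an isolated vertex. -/
theorem not_connected_of_isSaturated (hsat : isSaturated (edgesCode es) = true) :
    ¬ G.Connected := by
  intro hconn
  simp only [isSaturated, Bool.and_eq_true, List.all_eq_true, List.any_eq_true, Bool.or_eq_true,
    Bool.not_eq_true', ← Bool.not_eq_true (Nat.beq _ _)] at hsat
  simp only [Nat.beq_eq] at hsat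
  obtain ⟨hall, ⟨x, -, hx⟩, y, -, hy⟩ := hsat
  obtain ⟨p⟩ := hconn.preconnected (f y) (f x)
  have key : ∀ u v : Fin 12, G.Walk (f u) (f v) → codeRow (edgesCode es) u ≠ 0 →
      codeRow (edgesCode es) v ≠ 0 := by
    intro u v p
    generalize hu : f u = a at p
    generalize hv : f v = b at p
    induction p generalizing u with
    | nil => intro h; rwa [← hf (hu.trans hv.symm)]
    | cons h p ih =>
      rename_i c _
      intro hu0
      obtain ⟨w, hw⟩ := Finite.injective_iff_surjective.1 hf c
      refine ih w hw hv ?_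
      rw [← hu, ← hw] at h
      have := adjBit_of_adj_of_not_hasFewBits hG hf hadj h
        (((hall u (mem_vertexList u)).resolve_left hu0))
      rw [Ne, codeRow_eq_zero_iff]
      intro h0
      rw [adjBit_edgesCode_comm, h0] at this
      simp at this
  exact key y x p hy hx
end

/-! ### Soundness of the search -/

/-- That the accumulator only grows at its head is part of the claim: a graph used to discard
another one must survive to the end of the level. -/
theorem expand_spec {es : List (Fin 12 × Fin 12)} {v : Fin 12} {ws : List (Fin 12)} {d : ℕ}
    {acc acc' : List (List (Fin 12 × Fin 12))} (h : expand es v ws d acc = some acc') :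
    acc <:+ acc' ∧ ∀ G : SimpleGraph (Fin 12), G.Connected → IsCubic G →
      ∀ w ∈ ws, ContainsCopy G ((v, w) :: es) → ∃ b ∈ acc', ContainsCopy G b := by
  induction ws generalizing d acc with
  | nil =>
    simp only [expand, Option.some.injEq] at h
    simp [h]
  | cons w ws ih =>
    rw [expand] at h
    split at h
    · obtain ⟨h1, h2⟩ := ih h
      refine ⟨(List.suffix_cons _ _).trans h1, fun G hconn hcub x hx hG => ?_⟩
      rcases List.mem_cons.1 hx with rfl | hx
      · exact ⟨_, h1.subset List.mem_cons_self, hG⟩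
      · exact h2 G hconn hcub x hx hG
    · split at h
      · rename_i hsat
        obtain ⟨h1, h2⟩ := ih h
        refine ⟨h1, fun G hconn hcub x hx hG => ?_⟩
        rcases List.mem_cons.1 hx with rfl | hx
        · obtain ⟨f, hf, hadj⟩ := hG
          exact absurd hconn (not_connected_of_isSaturated hcub hf hadj hsat)
        · exact h2 G hconn hcub x hx hG
      · cases h
    · split at h
      · cases h
      · rename_i b l hdrop
        split at h
        · rename_i hemb
          obtain ⟨h1, h2⟩ := ih h
          refine ⟨h1, fun G hconn hcub x hx hG => ?_⟩
          rcases List.mem_cons.1 hx with rfl | hx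
          · exact ⟨b, h1.subset (List.mem_of_mem_drop (hdrop ▸ List.mem_cons_self)),
              hG.of_isEmbedding hemb⟩
          · exact h2 G hconn hcub x hx hG
        · cases h

theorem nextLevel_spec {L : List (List (Fin 12 × Fin 12))} {ds : List ℕ}
    {acc acc' : List (List (Fin 12 × Fin 12))} (h : nextLevel L ds acc = some acc') :
    acc <:+ acc' ∧ ∀ G : SimpleGraph (Fin 12), G.Connected → IsCubic G →
      ∀ es ∈ L, ContainsCopy G es → ∃ b ∈ acc', ContainsCopy G b := by
  induction L generalizing ds acc with
  | nil =>
    simp only [nextLevel, Option.some.injEq] at h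
    simp [h]
  | cons es L ih =>
    cases ds with
    | nil => cases h
    | cons d ds =>
      rw [nextLevel] at h
      split at h
      · rename_i hfew
        split at h
        · cases h
        · rename_i acc₁ hexp
          obtain ⟨h1, h2⟩ := expand_spec hexp
          obtain ⟨h3, h4⟩ := ih h
          refine ⟨h1.trans h3, fun G hconn hcub x hx hG => ?_⟩
          rcases List.mem_cons.1 hx with rfl | hx
          · obtain ⟨f, hf, hadj⟩ := hG
            obtain ⟨w, hw, hG⟩ := exists_containsCopy_candidates hcub hf hadj _ hfew
            obtain ⟨b, hb, hG⟩ := h2 G hconn hcub w hw hG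
            exact ⟨b, h3.subset hb, hG⟩
          · exact h4 G hconn hcub x hx hG
      · cases h

theorem allLevels_spec {data : List (List ℕ)} {L L' : List (List (Fin 12 × Fin 12))}
    (h : allLevels data L = some L') (G : SimpleGraph (Fin 12)) (hconn : G.Connected)
    (hcub : IsCubic G) (hG : ∃ b ∈ L, ContainsCopy G b) : ∃ b ∈ L', ContainsCopy G b := by
  induction data generalizing L with
  | nil =>
    simp only [allLevels, Option.some.injEq] at h
    rwa [← h]
  | cons ds data ih =>
    rw [allLevels] at h
    split at h
    · cases h
    · rename_i L₁ hnext
      obtain ⟨b, hb, hG⟩ := hG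
      exact ih h ((nextLevel_spec hnext).2 G hconn hcub b hb hG)

theorem exists_containsCopy_of_isCompleteSearch {data : List (List ℕ)} {ds ns : List ℕ}
    (h : isCompleteSearch data ds ns = true) (G : SimpleGraph (Fin 12)) (hconn : G.Connected)
    (hcub : IsCubic G) : ∃ n ∈ ns, ContainsCopy G (codeEdges n) := by
  rw [isCompleteSearch] at h
  split at h
  · cases h
  · rename_i L hL
    split at h
    · cases h
    · rename_i L' hL'
      obtain ⟨b, hb, hG⟩ := allLevels_spec hL G hconn hcub
        -- The search starts from the graph without edges, of which every graph contains a copy.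
        ⟨[], List.mem_singleton_self _, id, Function.injective_id, by simp⟩
      obtain ⟨h1, h2⟩ := nextLevel_spec hL'
      obtain ⟨b', hb', hG'⟩ := h2 G hconn hcub b hb hG
      rw [Nat.beq_eq] at h
      -- The proposed list is a suffix of the final one and has the same length, hence is all of it.
      rw [← h1.eq_of_length h.symm, List.mem_map] at hb'
      obtain ⟨n, hn, rfl⟩ := hb'
      exact ⟨n, hn, hG'⟩

/-! ### Cubic graphs given by codes -/

/-- The graph on `Fin 12` with a given adjacency matrix. -/
def codeGraph (n : ℕ) : SimpleGraph (Fin 12) := SimpleGraph.fromRel fun i j => adjBit n i j = true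

instance (n : ℕ) : DecidableRel (codeGraph n).Adj :=
  inferInstanceAs (DecidableRel (SimpleGraph.fromRel _).Adj)

/-- Whether a number is the adjacency matrix of a cubic graph. -/
def isCubicCode (n : ℕ) : Bool :=
  vertexList.all fun i => !adjBit n i i && (Nat.beq (vertexList.countP fun j => adjBit n i j) 3 &&
    vertexList.all fun j => adjBit n i j == adjBit n j i)

section
variable {n : ℕ} (hn : isCubicCode n = true)
include hn

theorem codeGraph_adj {i j : Fin 12} : (codeGraph n).Adj i j ↔ adjBit n i j = true := by
  simp only [isCubicCode, List.all_eq_true, Bool.and_eq_true, Bool.not_eq_true', beq_iff_eq] at hn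
  have h1 := (hn i (mem_vertexList i)).1
  have h2 := (hn i (mem_vertexList i)).2.2 j (mem_vertexList j)
  rw [codeGraph, SimpleGraph.fromRel_adj, ← h2, or_self, and_iff_right_iff_imp]
  rintro h rfl
  simp [h1] at h

theorem card_filter_adjBit (i : Fin 12) :
    (Finset.univ.filter fun j => adjBit n i j = true).card = 3 := by
  simp only [isCubicCode, List.all_eq_true, Bool.and_eq_true, Nat.beq_eq] at hn
  rw [← countP_vertexList]
  exact (hn i (mem_vertexList i)).2.1

theorem isCubic_codeGraph : IsCubic (codeGraph n) := by
  classical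
  intro v
  rw [← SimpleGraph.card_neighborFinset_eq_degree, ← card_filter_adjBit hn v]
  congr 1
  ext w
  simp [codeGraph_adj hn]

/-- The three neighbors of `i` have distinct images among the three neighbors of `f i`, hence
exhaust them. So `f` reflects adjacency as well as preserving it. -/
theorem nonempty_iso_of_containsCopy {G : SimpleGraph (Fin 12)} (hG : IsCubic G)
    (h : ContainsCopy G (codeEdges n)) : Nonempty (G ≃g codeGraph n) := by
  classical
  obtain ⟨f, hf, hadj⟩ := h
  have hlt : ∀ i j : Fin 12, i < j → adjBit n i j = true → G.Adj (f i) (f j) := by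
    intro i j hij h
    refine hadj (i, j) (List.mem_flatMap.2 ⟨i, mem_vertexList i, List.mem_map.2 ⟨j, ?_, rfl⟩⟩)
    rw [List.mem_filter, Bool.and_eq_true]
    exact ⟨mem_vertexList j, Nat.blt_eq.to_iff.2 hij, h⟩
  have hmap : ∀ i j : Fin 12, adjBit n i j = true → G.Adj (f i) (f j) := by
    intro i j h
    rcases lt_trichotomy i j with hij | rfl | hij
    · exact hlt i j hij h
    · exact absurd ((codeGraph_adj hn).2 h) (SimpleGraph.irrefl _)
    · exact (hlt j i hij ((codeGraph_adj hn).1 ((codeGraph_adj hn).2 h).symm)).symm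
  have hiff : ∀ i j : Fin 12, G.Adj (f i) (f j) ↔ adjBit n i j = true := by
    intro i j
    refine ⟨fun h => ?_, hmap i j⟩
    have hs : (Finset.univ.filter fun j => adjBit n i j = true).image f =
        Finset.univ.filter fun x => G.Adj (f i) x := by
      refine Finset.eq_of_subset_of_card_le ?_ ?_
      · intro x hx
        obtain ⟨j, hj, rfl⟩ := Finset.mem_image.1 hx
        simpa using hmap i j (by simpa using hj)
      · rw [hG.card_filter_adj, Finset.card_image_of_injective _ hf, card_filter_adjBit hn]
    have : f j ∈ (Finset.univ.filter fun j => adjBit n i j = true).image f := by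
      rw [hs]; simpa using h
    obtain ⟨j', hj', hjj'⟩ := Finset.mem_image.1 this
    rw [← hf hjj']
    simpa using hj'
  exact ⟨(RelIso.mk (Equiv.ofBijective f (Finite.injective_iff_bijective.1 hf))
    (by intro i j; exact (hiff i j).trans (codeGraph_adj hn).symm) : codeGraph n ≃g G).symm⟩
end

/-! ### Reachability, connectedness and bridges -/

/-- One round of adding the neighbors of the vertices of a set in the graph `n`. -/
def reachStep (n : ℕ) : List (Fin 12) → ℕ → ℕ
  | [], m => m
  | v :: vs, m => reachStep n vs (bif m.testBit v.val then m ||| codeRow n v else m)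

/-- Repeated addition of the neighbors of the vertices of a set in the graph `n`. -/
def reachSet (n : ℕ) : ℕ → ℕ → ℕ
  | 0, m => m
  | k + 1, m => reachSet n k (reachStep n vertexList m)

section
variable {n : ℕ} {P : Fin 12 → Prop} (hP : ∀ x y, adjBit n x y = true → P x → P y)
include hP

/-- Only soundness of the closure computation is needed. It is stated for any property that passes
along edges, since it serves both for reachability and for lying on the same side of a cut. -/
theorem reachStep_spec {vs : List (Fin 12)} {m : ℕ}
    (hm : ∀ x : Fin 12, m.testBit x.val = true → P x) (x : Fin 12)
    (hx : (reachStep n vs m).testBit x.val = true) : P x := by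
  induction vs generalizing m with
  | nil => exact hm x hx
  | cons v vs ih =>
    refine ih (fun y hy => ?_) hx
    cases hv : m.testBit v.val with
    | false => rw [hv] at hy; exact hm y hy
    | true =>
      rw [hv, cond_true, Nat.testBit_or, Bool.or_eq_true, testBit_codeRow] at hy
      exact hy.elim (hm y) fun hy => hP v y hy (hm v hv)

theorem reachSet_spec {k m : ℕ} (hm : ∀ x : Fin 12, m.testBit x.val = true → P x) (x : Fin 12)
    (hx : (reachSet n k m).testBit x.val = true) : P x := by
  induction k generalizing m with
  | zero => exact hm x hx
  | succ k ih => exact ih (reachStep_spec hP hm) hx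

end

theorem connected_codeGraph {n : ℕ} (hn : isCubicCode n = true) (h : reachSet n 11 1 = 4095) :
    (codeGraph n).Connected := by
  have key : ∀ x : Fin 12, (codeGraph n).Reachable 0 x := by
    intro x
    refine reachSet_spec (n := n) (P := fun x => (codeGraph n).Reachable 0 x) (k := 11) (m := 1)
      (fun x y hxy hx => hx.trans ((codeGraph_adj hn).2 hxy).reachable) (fun x hx => ?_) x ?_
    · rw [Nat.testBit_one_eq_true_iff_self_eq_zero] at hx
      rw [show x = 0 from Fin.ext hx]
    · rw [h]; revert x; decide
  exact ⟨fun x y => (key x).symm.trans (key y)⟩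

/-- For a bridge `uv` take as `S` the vertices reachable from `u` once the edge is deleted.
Conversely, a walk from `u` to `v` avoiding the edge would have to leave `S` through it. In the form
of a cut a bridge can be certified by a bit mask. -/
theorem hasBridge_iff_exists_cut {V : Type*} {G : SimpleGraph V} :
    HasBridge G ↔ ∃ u v, G.Adj u v ∧ ∃ S : Set V, u ∈ S ∧ v ∉ S ∧
      ∀ x y, G.Adj x y → x ∈ S → y ∉ S → x = u ∧ y = v := by
  constructor
  · rintro ⟨e, he, hb⟩
    induction e with
    | h u v =>
      refine ⟨u, v, he, {x | (G.deleteEdges {s(u, v)}).Reachable u x}, .refl u, hb, ?_⟩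
      intro x y hxy hx hy
      by_contra hne
      have hmem : s(x, y) = s(u, v) := by
        by_contra hs
        refine hy (SimpleGraph.Reachable.trans hx (SimpleGraph.Adj.reachable ?_))
        rw [SimpleGraph.deleteEdges_adj]
        exact ⟨hxy, hs⟩
      rw [Sym2.eq_iff] at hmem
      rcases hmem with h | ⟨rfl, rfl⟩
      · exact hne h
      · exact hy (.refl _)
  · rintro ⟨u, v, huv, S, hu, hv, hS⟩
    refine ⟨s(u, v), huv, fun ⟨p⟩ => ?_⟩
    obtain ⟨d, -, h1, h2⟩ := p.exists_boundary_dart S hu hv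
    have had := d.adj
    rw [SimpleGraph.deleteEdges_adj] at had
    obtain ⟨h3, h4⟩ := hS _ _ had.1 h1 h2
    exact had.2 (by rw [h3, h4]; rfl)

theorem HasBridge.of_iso {V W : Type*} {G : SimpleGraph V} {H : SimpleGraph W} (e : G ≃g H)
    (h : HasBridge G) : HasBridge H := by
  rw [hasBridge_iff_exists_cut] at h ⊢
  obtain ⟨u, v, huv, S, hu, hv, hS⟩ := h
  refine ⟨e u, e v, e.map_adj_iff.2 huv, e.symm ⁻¹' S, by simpa, by simpa, fun x y hxy hx hy => ?_⟩
  obtain ⟨h1, h2⟩ := hS _ _ (e.symm.map_adj_iff.2 hxy) hx hy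
  exact ⟨by rw [← h1, RelIso.apply_symm_apply], by rw [← h2, RelIso.apply_symm_apply]⟩

/-- Whether no edge of the graph `n` is a bridge. -/
def isBridgeless (n : ℕ) : Bool :=
  (codeEdges n).all fun e =>
    (reachSet (edgesCode ((codeEdges n).filter fun e' => !decide (e' = e))) 11
      (2 ^ e.1.val)).testBit e.2.val

theorem mem_codeEdges {n : ℕ} {i j : Fin 12} :
    (i, j) ∈ codeEdges n ↔ i < j ∧ adjBit n i j = true := by
  simp [codeEdges, mem_vertexList, Nat.blt_eq]

/-- If `uv` were the only edge leaving `S`, all other edges would stay on one side. The computed set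
reaches the second end of each edge from the first without using that edge, so `u` and `v` would lie
on the same side. -/
theorem not_hasBridge_codeGraph {n : ℕ} (hn : isCubicCode n = true) (h : isBridgeless n = true) :
    ¬ HasBridge (codeGraph n) := by
  rw [hasBridge_iff_exists_cut]
  rintro ⟨u, v, huv, S, hu, hv, hS⟩
  have hcut : ∀ x y, (codeGraph n).Adj x y → s(x, y) ≠ s(u, v) → (x ∈ S ↔ y ∈ S) := by
    intro x y hxy hne
    constructor <;> intro h1 <;> by_contra h2
    · obtain ⟨rfl, rfl⟩ := hS x y hxy h1 h2
      exact hne rfl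
    · obtain ⟨rfl, rfl⟩ := hS y x hxy.symm h1 h2
      exact hne Sym2.eq_swap
  have key : ∀ a b, a < b → s(a, b) = s(u, v) → (a ∈ S ↔ b ∈ S) := by
    intro a b hab he
    have hmem : (a, b) ∈ codeEdges n := by
      refine mem_codeEdges.2 ⟨hab, (codeGraph_adj hn).1 ?_⟩
      rw [← SimpleGraph.mem_edgeSet, he]
      exact huv
    have hr := List.all_eq_true.1 h _ hmem
    refine (reachSet_spec (P := fun x => a ∈ S ↔ x ∈ S) ?_ ?_ b hr)
    · have step : ∀ x y, (x, y) ∈ (codeEdges n).filter (fun e' => !decide (e' = (a, b))) →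
          (x ∈ S ↔ y ∈ S) := by
        intro x y hxy
        rw [List.mem_filter, mem_codeEdges, Bool.not_eq_true', decide_eq_false_iff_not,
          Prod.mk.injEq] at hxy
        refine hcut x y ((codeGraph_adj hn).2 hxy.1.2) ?_
        rw [← he, Ne, Sym2.eq_iff]
        rintro (h | ⟨rfl, rfl⟩)
        · exact hxy.2 h
        · exact absurd hxy.1.1 hab.asymm
      intro x y hxy hx
      rw [adjBit_edgesCode] at hxy
      exact hxy.elim (fun h => hx.trans (step x y h)) fun h => hx.trans (step y x h).symm
    · intro x hx
      rw [Nat.testBit_two_pow, decide_eq_true_eq] at hx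
      rw [show x = a from (Fin.ext hx).symm]
  -- `codeEdges` lists each edge with its smaller end first, whereas the cut orients it from `u` to
  -- `v`.
  rcases lt_trichotomy u v with huv' | rfl | huv'
  · exact hv ((key u v huv' rfl).1 hu)
  · exact hv hu
  · exact hv ((key v u huv' Sym2.eq_swap).2 hu)

/-- Whether the only edge of the graph `n` that leaves the set `m` is `uv`. -/
def isBridgeCut (n m : ℕ) (u v : Fin 12) : Bool :=
  (adjBit n u v && (m.testBit u.val && !m.testBit v.val)) &&
    vertexList.all fun x => vertexList.all fun y =>
      !(adjBit n x y && (m.testBit x.val && !m.testBit y.val)) || (decide (x = u) && decide (y = v))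

theorem hasBridge_codeGraph {n m : ℕ} {u v : Fin 12} (hn : isCubicCode n = true)
    (h : isBridgeCut n m u v = true) : HasBridge (codeGraph n) := by
  simp only [isBridgeCut, Bool.and_eq_true, Bool.not_eq_true', List.all_eq_true, Bool.or_eq_true,
    decide_eq_true_eq, ← Bool.not_eq_true (_ && _)] at h
  obtain ⟨⟨huv, hu, hv⟩, hall⟩ := h
  refine hasBridge_iff_exists_cut.2 ⟨u, v, (codeGraph_adj hn).2 huv,
    {x | m.testBit x.val = true}, hu, by simp [hv], fun x y hxy hx hy => ?_⟩
  refine (hall x (mem_vertexList x) y (mem_vertexList y)).resolve_left (not_not.2 ?_)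
  exact ⟨(codeGraph_adj hn).1 hxy, hx, by simpa using hy⟩

/-! ### Exhaustive backtracking -/

section
variable {ι α : Type*}

/-- Whether the variables in a list can be given values in the list `dom` that are compatible, as
decided by `ok`, with each other and with a list of values given before. -/
def isSolvable (dom : List α) (ok : ι → ι → α → α → Bool) : List ι → List (ι × α) → Bool
  | [], _ => true
  | i :: is, as => dom.any fun x =>
    (as.all fun a => ok i a.1 x a.2) && isSolvable dom ok is ((i, x) :: as)

/-- A global solution `f` is a branch that the search never prunes. Only this direction is needed: a
failed search proves that no solution exists. -/
theorem isSolvable_of_pairwise {dom : List α} {ok : ι → ι → α → α → Bool} {is : List ι}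
    {as : List (ι × α)} (f : ι → α) (hdom : ∀ i, f i ∈ dom)
    (his : is.Pairwise fun j i => ok i j (f i) (f j) = true)
    (has : ∀ i ∈ is, ∀ a ∈ as, ok i a.1 (f i) a.2 = true) : isSolvable dom ok is as = true := by
  induction is generalizing as with
  | nil => rfl
  | cons i is ih =>
    rw [List.pairwise_cons] at his
    rw [isSolvable, List.any_eq_true]
    refine ⟨f i, hdom i, ?_⟩
    rw [Bool.and_eq_true, List.all_eq_true]
    refine ⟨has i List.mem_cons_self, ih his.2 fun j hj a ha => ?_⟩
    rcases List.mem_cons.1 ha with rfl | ha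
    · exact his.1 j hj
    · exact has j (List.mem_cons_of_mem _ hj) a ha

end

/-! ### Balanced colorings and excluded subgraphs -/

theorem IsBalancedColoring.ne_of_adj {G : SimpleGraph (Fin 12)} {ℓ : Fin 12 → ZMod 3}
    (hG : IsCubic G) (hℓ : IsBalancedColoring G ℓ) {v x y : Fin 12} (hx : G.Adj v x)
    (hy : G.Adj v y) (hxy : x ≠ y) : ℓ x ≠ ℓ y := by
  classical
  have hcard : ∀ i, (G.neighborSet v ∩ ℓ ⁻¹' {i}).ncard =
      ((Finset.univ.filter fun w => G.Adj v w).filter fun w => ℓ w = i).card := by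
    intro i
    rw [← Set.ncard_coe_finset]
    congr 1
    ext w
    simp
  have hsum := Finset.card_eq_sum_card_fiberwise (f := ℓ)
    (s := Finset.univ.filter fun w => G.Adj v w) (t := Finset.univ) (by simp)
  -- All color classes in the neighborhood are as large as that of `ℓ y`, so 3 is three times this
  -- size and each color occurs once.
  rw [hG.card_filter_adj, Finset.sum_congr rfl fun i _ =>
    ((hcard i).symm.trans (hℓ v i (ℓ y))).trans (hcard (ℓ y)), Finset.sum_const,
    Finset.card_univ, ZMod.card, smul_eq_mul] at hsum
  intro h
  have hone : ((Finset.univ.filter fun w => G.Adj v w).filter fun w => ℓ w = ℓ y).card ≤ 1 := by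
    omega
  refine hxy (Finset.card_le_one.1 hone x ?_ y ?_)
  · simp [hx, h]
  · simp [hy]

theorem IsBalancedColoring.of_iso {G H : SimpleGraph (Fin 12)} {ℓ : Fin 12 → ZMod 3} (e : G ≃g H)
    (h : IsBalancedColoring G ℓ) : IsBalancedColoring H (ℓ ∘ e.symm) := by
  have key : ∀ v i, (H.neighborSet v ∩ (ℓ ∘ e.symm) ⁻¹' {i}).ncard =
      (G.neighborSet (e.symm v) ∩ ℓ ⁻¹' {i}).ncard := by
    intro v i
    rw [← Set.ncard_image_of_injective _ e.symm.injective]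
    congr 1
    ext w
    simp only [Set.mem_image, Set.mem_inter_iff, SimpleGraph.mem_neighborSet, Set.mem_preimage,
      Function.comp_apply, Set.mem_singleton_iff]
    constructor
    · rintro ⟨x, ⟨hx, hi⟩, rfl⟩
      exact ⟨e.symm.map_adj_iff.2 hx, hi⟩
    · rintro ⟨hw, hi⟩
      refine ⟨e w, ⟨?_, by simpa using hi⟩, by simp⟩
      rw [← e.symm.map_adj_iff]
      simpa using hw
  intro v i j
  rw [key, key]
  exact h _ i j

theorem IsThreeBalanced.of_iso {G H : SimpleGraph (Fin 12)} (e : G ≃g H) (h : IsThreeBalanced G) :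
    IsThreeBalanced H := by
  obtain ⟨ℓ, hℓ⟩ := h
  exact ⟨_, hℓ.of_iso e⟩

theorem Obstruction.Holds.of_iso {G H : SimpleGraph (Fin 12)} (e : G ≃g H) {o : Obstruction}
    (h : o.Holds G) : o.Holds H := by
  cases o
  case bridge => exact HasBridge.of_iso e h
  case tietze => exact ⟨e.symm.trans (Nonempty.some h)⟩
  all_goals exact SimpleGraph.IsContained.trans h e.isContained

/-- Whether the graph `n` has a vertex coloring with three colors such that no vertex has two
neighbors of the same color. -/
def hasRainbowColoring (n : ℕ) : Bool :=
  isSolvable [(0 : Fin 3), 1, 2] (fun i j x y => !decide (x = y) ||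
    !vertexList.any fun k => adjBit n k i && adjBit n k j) vertexList []

/-- A balanced coloring of `G`, pulled back along the copy, separates any two neighbors of a common
vertex of the subgraph. -/
theorem not_isThreeBalanced_of_containsCopy {G : SimpleGraph (Fin 12)} (hG : IsCubic G)
    {es : List (Fin 12 × Fin 12)} (hes : hasRainbowColoring (edgesCode es) = false)
    (h : ContainsCopy G es) : ¬ IsThreeBalanced G := by
  rintro ⟨ℓ, hℓ⟩
  obtain ⟨f, hf, hadj⟩ := h
  refine Bool.false_ne_true (hes.symm.trans ?_)
  refine isSolvable_of_pairwise (fun i => (ℓ (f i) : Fin 3)) (fun i => ?_) ?_ (by simp)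
  · have h3 : ∀ c : Fin 3, c ∈ [0, 1, 2] := by decide
    exact h3 _
  · have hnd : vertexList.Nodup := by decide
    refine hnd.imp fun {j i} hij => ?_
    rw [Bool.or_eq_true, Bool.not_eq_true', decide_eq_false_iff_not, Bool.not_eq_true',
      ← Bool.not_eq_true, ← imp_iff_not_or, List.any_eq_true]
    rintro hc ⟨k, -, hk⟩
    rw [Bool.and_eq_true] at hk
    exact IsBalancedColoring.ne_of_adj hG hℓ (adj_of_adjBit hadj hk.1) (adj_of_adjBit hadj hk.2)
      (hf.ne hij.symm) hc

/-- Whether the graph `m` contains a copy of the graph `n`. -/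
def hasCopy (n m : ℕ) : Bool :=
  isSolvable vertexList (fun i j x y => !decide (x = y) && (!adjBit n i j || adjBit m x y))
    vertexList []

theorem not_containsCopy_codeGraph {m : ℕ} (hm : isCubicCode m = true)
    {es : List (Fin 12 × Fin 12)} (h : hasCopy (edgesCode es) m = false) :
    ¬ ContainsCopy (codeGraph m) es := by
  rintro ⟨f, hf, hadj⟩
  refine Bool.false_ne_true (h.symm.trans ?_)
  refine isSolvable_of_pairwise f (fun i => mem_vertexList _) ?_ (by simp)
  have hnd : vertexList.Nodup := by decide
  refine hnd.imp fun {j i} hij => ?_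
  rw [Bool.and_eq_true, Bool.not_eq_true', decide_eq_false_iff_not, Bool.or_eq_true,
    Bool.not_eq_true', ← Bool.not_eq_true, ← imp_iff_not_or]
  exact ⟨hf.ne hij.symm, fun h => (codeGraph_adj hm).1 (adj_of_adjBit hadj h)⟩

/-- Adding isolated vertices up to 12 does not affect containment in a graph on 12 vertices, since
an injection on part of the vertices extends to a permutation. All obstructions can thus be handled
as edge lists on `Fin 12`. -/
theorem isContained_iff_containsCopy {n : ℕ} (hn : n ≤ 12) {F : SimpleGraph (Fin n)}
    {es : List (Fin 12 × Fin 12)} (hF : ∀ i j, F.Adj i j ↔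
      (Fin.castLE hn i, Fin.castLE hn j) ∈ es ∨ (Fin.castLE hn j, Fin.castLE hn i) ∈ es)
    (hes : ∀ e ∈ es, e.1.val < n ∧ e.2.val < n) {G : SimpleGraph (Fin 12)} :
    F.IsContained G ↔ ContainsCopy G es := by
  constructor
  · rintro ⟨f⟩
    let f' : Fin 12 → Fin 12 := fun i => if h : i.val < n then f ⟨i.val, h⟩ else 0
    have hf' : ∀ i, f' (Fin.castLE hn i) = f i := fun i => by simp [f']
    obtain ⟨g, hg⟩ := Set.MapsTo.exists_equiv_extend_of_card_eq (t := Finset.univ)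
      (s := Set.range (Fin.castLE hn)) (f := f') (by simp) (fun _ _ => by simp) (by
        rintro _ ⟨i, rfl⟩ _ ⟨j, rfl⟩ hij
        rw [hf', hf'] at hij
        rw [f.injective hij])
    refine ⟨fun i => g i, Subtype.val_injective.comp g.injective, fun e he => ?_⟩
    obtain ⟨h1, h2⟩ := hes e he
    have h := (hF ⟨e.1, h1⟩ ⟨e.2, h2⟩).2 (Or.inl he)
    have h3 := (hg _ ⟨⟨e.1, h1⟩, rfl⟩).trans (hf' _)
    have h4 := (hg _ ⟨⟨e.2, h2⟩, rfl⟩).trans (hf' _)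
    have h5 := f.toHom.map_adj h
    rw [← SimpleGraph.Copy.coe_toHom] at h3 h4
    rw [← h3, ← h4] at h5
    exact h5
  · rintro ⟨f, hf, hadj⟩
    refine ⟨⟨⟨f ∘ Fin.castLE hn, fun {i j} h => ?_⟩, hf.comp (Fin.castLE_injective hn)⟩⟩
    exact ((hF i j).1 h).elim (fun h => hadj _ h) fun h => (hadj _ h).symm

/-! ### The isomorphism invariant -/

/-- The number of walks of length at most 1 from `u` to `v`. -/
noncomputable def stayOrStep {V : Type*} (G : SimpleGraph V) (u v : V) : ℕ := by
  classical exact if u = v ∨ G.Adj u v then 1 else 0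

/-- The sum of the third powers of the entries of the third power of the matrix `1 + A`, where `A`
is the adjacency matrix. -/
noncomputable def cubicInvariant {V : Type*} [Fintype V] (G : SimpleGraph V) : ℕ :=
  ∑ u, ∑ v, (∑ x, stayOrStep G u x * ∑ y, stayOrStep G x y * stayOrStep G y v) ^ 3

theorem cubicInvariant_congr {V W : Type*} [Fintype V] [Fintype W] {G : SimpleGraph V}
    {H : SimpleGraph W} (e : G ≃g H) : cubicInvariant G = cubicInvariant H := by
  have h : ∀ u v, stayOrStep G u v = stayOrStep H (e u) (e v) := fun u v => by
    have h1 : e u = e v ∨ H.Adj (e u) (e v) ↔ u = v ∨ G.Adj u v := by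
      rw [e.injective.eq_iff, e.map_adj_iff]
    by_cases hc : u = v ∨ G.Adj u v
    · rw [stayOrStep, stayOrStep, if_pos hc, if_pos (h1.2 hc)]
    · rw [stayOrStep, stayOrStep, if_neg hc, if_neg (mt h1.1 hc)]
  have hsum : ∀ F : W → ℕ, ∑ x, F (e x) = ∑ x, F x := fun F => Equiv.sum_comp e.toEquiv F
  rw [cubicInvariant, cubicInvariant, ← hsum]
  refine Finset.sum_congr rfl fun u _ => ?_
  rw [← hsum]
  refine Finset.sum_congr rfl fun v _ => ?_
  rw [← hsum]
  refine congrArg (· ^ 3) (Finset.sum_congr rfl fun x _ => ?_)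
  rw [← hsum, h]
  exact congrArg _ (Finset.sum_congr rfl fun y _ => by rw [h, h])

/-- The sum of the values of a function on a list. -/
def listSum (f : Fin 12 → ℕ) : List (Fin 12) → ℕ
  | [] => 0
  | i :: is => Nat.add (f i) (listSum f is)

/-- The list of the vertices of the graph `n` at distance at most 1 from `i`. -/
def closedNeighbors (n : ℕ) (i : Fin 12) : List (Fin 12) :=
  vertexList.filter fun j => Nat.beq i.val j.val || adjBit n i j

/-- The rows of the `k`-th power of the matrix `1 + A`, as numbers in base 256. -/
def packedRow (n : ℕ) : ℕ → Fin 12 → ℕ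
  | 0, u => Nat.pow 256 u.val
  | k + 1, u => listSum (packedRow n k) (closedNeighbors n u)

/-- A way to compute `cubicInvariant`. -/
def codeInvariant (n : ℕ) : ℕ :=
  listSum (fun u => listSum (fun v =>
    Nat.pow (Nat.mod (Nat.div (packedRow n 3 u) (Nat.pow 256 v.val)) 256) 3) vertexList) vertexList

theorem listSum_vertexList (f : Fin 12 → ℕ) : listSum f vertexList = ∑ i, f i := by
  have h : List.finRange 12 = vertexList := by decide
  rw [Fin.sum_univ_def, h]
  generalize vertexList = l
  induction l with
  | nil => rfl
  | cons a l ih => rw [listSum, ih, List.map_cons, List.sum_cons]; rfl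

theorem listSum_filter (f : Fin 12 → ℕ) (p : Fin 12 → Bool) (l : List (Fin 12)) :
    listSum f (l.filter p) = listSum (fun i => (bif p i then 1 else 0) * f i) l := by
  induction l with
  | nil => rfl
  | cons a l ih =>
    cases h : p a
    · rw [List.filter_cons_of_neg (by simp [h]), ih, listSum, h, cond_false, Nat.zero_mul]
      exact (Nat.zero_add _).symm
    · rw [List.filter_cons_of_pos h, listSum, ih, listSum, h, cond_true, Nat.one_mul]

theorem digit_of_sum (f : Fin 12 → ℕ) (hf : ∀ i, f i < 256) (j : Fin 12) :
    (∑ i, f i * 256 ^ i.val) / 256 ^ j.val % 256 = f j := by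
  have h := hf
  simp only [Fin.forall_fin_succ, Fin.sum_univ_succ] at h ⊢
  fin_cases j <;> simp at h ⊢ <;> omega

theorem stayOrStep_le_one {V : Type*} (G : SimpleGraph V) (u v : V) : stayOrStep G u v ≤ 1 := by
  rw [stayOrStep]
  split <;> simp

/-- Multiplying by `1 + A` adds up the rows over closed neighborhoods. With whole rows packed into
single numbers this is ordinary addition, and the entries can be recovered at the end as long as
they stay below the base 256. -/
theorem cubicInvariant_codeGraph {n : ℕ} (hn : isCubicCode n = true) :
    cubicInvariant (codeGraph n) = codeInvariant n := by
  set K := stayOrStep (codeGraph n)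
  have hK : ∀ i j, (bif Nat.beq i.val j.val || adjBit n i j then 1 else 0) = K i j := by
    intro i j
    simp only [K, stayOrStep, codeGraph_adj hn, cond_eq_ite, Bool.or_eq_true, Nat.beq_eq,
      Fin.ext_iff]
  have hrow : ∀ k u, packedRow n (k + 1) u = ∑ x, K u x * packedRow n k x := by
    intro k u
    rw [packedRow, closedNeighbors, listSum_filter, listSum_vertexList]
    simp only [hK]
  have hrow3 : ∀ u, packedRow n 3 u = ∑ v, (∑ x, K u x * ∑ y, K x y * K y v) * 256 ^ v.val := by
    intro u
    simp only [hrow, Finset.mul_sum, Finset.sum_mul]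
    rw [Finset.sum_comm_cycle]
    refine Finset.sum_congr rfl fun v _ => Finset.sum_congr rfl fun x _ =>
      Finset.sum_congr rfl fun y _ => ?_
    rw [packedRow]
    simp only [Nat.pow_eq]
    ring
  -- The crude bound 12 · 12 = 144 on an entry of the third power suffices.
  have hlt : ∀ u v, ∑ x, K u x * ∑ y, K x y * K y v < 256 := by
    intro u v
    have h1 : ∀ a b, K a b ≤ 1 := stayOrStep_le_one _
    calc ∑ x, K u x * ∑ y, K x y * K y v ≤ ∑ _x : Fin 12, 1 * ∑ _y : Fin 12, 1 * 1 := by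
          gcongr <;> exact h1 _ _
      _ < 256 := by simp
  rw [codeInvariant, listSum_vertexList, cubicInvariant]
  refine Finset.sum_congr rfl fun u _ => ?_
  rw [listSum_vertexList]
  refine Finset.sum_congr rfl fun v _ => ?_
  rw [← digit_of_sum (fun v => ∑ x, K u x * ∑ y, K x y * K y v) (hlt u) v, ← hrow3]
  rfl

/-! ### The 85 representatives and the directions for the search -/

/-- The adjacency matrices of the connected cubic graphs on 12 vertices, up to isomorphism. -/
def representativeCodes : List ℕ := [
  0x501a40501a801504a00540a801602a00da02, 0x409a805402a05402a015002a81400b015806,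
  0x601a80d002815400a805202c05401a025902, 0x601a10d002c01421a005842803400b085806,
  0x481b005086809400a105202c21401a025842, 0x501a02501a801600a80d002c05401a405a02,
  0x481a045102c09401a005122801640a00d822, 0x481a025042c09401a005802903420a405812,
  0x411a205402811442a045082801608a00d902, 0x501a10540a801422a005442801502a08580a,
  0x411a205402841422a045082801510a08580a, 0x405a805022a05400a815002905480a205812,
  0x441a105042881428a005142811420a085822, 0x405a015802a03400b015006801680a00dc02,
  0x501a40501a801484a005402a09402a015a02, 0x411a205402821442a045082801508a10580a,
  0x501a02501a801500a80540a805402a405a02, 0x700b00c80c402601a00d002c01301300d00e,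
  0x700a80c408c05203200d002c01301300d00e, 0x680980940640c203200d002c01301300d00e,
  0x380380c40c40c203200d002c01301300d00e, 0x700b00c80c4026019009806402301300d00e,
  0x700a80c408c052031009806402301300d00e, 0x680980940640c2031009806402301300d00e,
  0x380380c40c40c2031009806402301300d00e, 0x700b00c80c402301300c80c402301300d00e,
  0x700b00c80c202500b01480c402301300d00e, 0x700a80c408a05102301480c402301300d00e,
  0x7009808c0c206102301480c402301300d00e, 0x380380c40c20c102301480c402301300d00e,
  0x700a80c208604501903080c402301300d00e, 0x7008c0920a204504903080c402301300d00e,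
  0x6809409206208504903080c402301300d00e, 0x380340c20c208504903080c402301300d00e,
  0x7008c08a08606105103080c402301300d00e, 0x6809408a0460a105103080c402301300d00e,
  0x580a404a0860a105103080c402301300d00e, 0x380340c20c1086049028814402301300d00e,
  0x700a80c1086046019018824402301300d00e, 0x680980940640c2031008c04a03102301500e,
  0x7009808c0c2061022814408a05102301500e, 0x680980940620c1022814408a05102301500e,
  0x680980860460c1030830408a05102301500e, 0x680a40c200e091050830408a05102301500e,
  0x6809408a0460a1050830408a05102301500e, 0x6808c0920260c1050830408a05102301500e,
  0x680980860430c082183041420c102301500e, 0x6809408a0430a084183041420c102301500e,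
  0x6809209206108480986041420c102301500e, 0x580a204608909082186041420c102301500e,
  0x680a20c100e09081185042420c102301500e, 0x2a0160890450a08508c043020c102301500e,
  0x700a80c408a051022814408a05102301500e, 0x380380c40c20c1022814408a05102301500e,
  0x7008c08a086061050830408a05102301500e, 0x580a404a0860a1050830408a05102301500e,
  0x2c01c0920620c10c0830408a05102301500e, 0x380340c20c208184183040c20c102301500e,
  0x380380c20c10c080382441420c102301500e, 0x380340c20c108284182841420c102301500e,
  0x7008a08608905082186041420c102301500e, 0x6408a08900706089085043020c102301500e,
  0x6208a08500d0508308c043020c102301500e, 0x2a01a0850450c08308c043020c102301500e,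
  0x7008c08a08506085082061060c103103100e, 0x3802c0c20850c085082061060c103103100e,
  0x580a40520a1084848420a1060a105103100e, 0x380340c20c1084848420a1060a105103100e,
  0x7008c086089050860420a1060a105103100e, 0x6809409106088284240c220618105103100e,
  0x380340c10c088284240c220618105103100e, 0x5408a0190a0860882444220618105103100e,
  0x70086089084822850448220618105103100e, 0x380260c1084882850448220618105103100e,
  0x1600e0190a08608c04c0220618105103100e, 0x2c01a0910608c0482844220614109103100e,
  0x3802c0c20860c1050830408a05102301500e, 0x580a40520a108284182841420c102301500e,
  0x6409208a04903088186041420c102301500e, 0x2c0320c1044882890448220618105103100e,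
  0x580a404288188244142821423010c103100e, 0x190260508a0482841448284228114103100e,
  0x540a204a08903088186041420c102301500e, 0x6808608300d09085086043020c102301500e,
  0x640a08c010911448a005212841408a025302]

/-- Directions for adding edge number 1. -/
def searchData0 : List ℕ := [
  12]

/-- Directions for adding edge number 2. -/
def searchData1 : List ℕ := [
  24]

/-- Directions for adding edge number 3. -/
def searchData2 : List ℕ := [
  36]

/-- Directions for adding edge number 4. -/
def searchData3 : List ℕ := [
  0x121844151a47004b1]

/-- Directions for adding edge number 5. -/
def searchData4 : List ℕ := [
  0x121844151a47004bd, 0x121844152833016b1]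

/-- Directions for adding edge number 6. -/
def searchData5 : List ℕ := [
  194, 0x486110354dcc0124a, 0x24aeee2a8d9ab2d331ae549c28081e]

/-- Directions for adding edge number 7. -/
def searchData6 : List ℕ := [
  0x1218440d524a004cb, 0x486110354dcc01256, 0x48611054a0cc07e4a,
  0x129786d2c01ff71ac04437eb1c2e0f05e654a0cc03aa, 63]

/-- Directions for adding edge number 8. -/
def searchData7 : List ℕ := [
  76, 64, 0x1218440d5373004cb, 0x4861104c495605eb, 0x4a5df0ac57e74ed491beb76dd544536008d5373004e3,
  0x48610edcb82801257, 0x24aeee1be8c2f2d3bd7654691c0cb7,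
  0x12977c33124e2afb931042c0184b84193cdc7bd41137, 0x24aeed6d41d407bf193e545fd4136b]

/-- Directions for adding edge number 9. -/
def searchData8 : List ℕ := [
  0x4860feb5b91c01264, 0x1218440d5373004da, 0x48610edcb82801263, 0x48611054a0cc07e57,
  0x129786d2c01ff71ac0438946875b58c5e654a0cc03b7,
  0x96bd9ff912b0d3c6fff251a0b911473186e41cdb567f2d3a6c91c060f,
  0x4a5d1dd643c6a986bca0b22158c0dcf5d371ef5031e3, 88, 0x121843b50a4080e5c,
  0x129786d2b1d20ce75411e7d4a2f3f7ab5a54691c0ef7, 0x121844151a4703b5b, 77,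
  0x24aed865ca8b5febb0c9aaf3821c78, 0x48610baaf3821c6c]

/-- Directions for adding edge number 10. -/
def searchData9 : List ℕ := [
  89, 0x12183a87b940804e6, 89, 89, 0x92bb94f720034f933cd7e2b5900f04,
  0x12918883a806626418f5b53dbae95017f0b5f0cc0127c, 0x24aeebb6ff6996fcc71d9dadcc1378, 89,
  0x24ae830286f94ae4cf35b72e0a004f0, 100, 0x12183fad6e47004e5, 0x1218440d5373004e7, 88,
  0x4860feb5b91c01270, 0x48611054a0cc07e64, 0x129786d2c01ff71ac03b5991e7957405e654a0cc03c4]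

/-- Directions for adding edge number 11. -/
def searchData10 : List ℕ := [
  0x12183fad6e47004e5, 101, 0x24a9e83b7a9edee4cf31ad6e47004fd, 113,
  0x24aee52dcb93ba1b993e354dcc1151, 101, 0x4861100b1a091eb9, 0x1218440d5373004f3, 100,
  0x12183fad6e47004f1, 0x121844152833016e5, 113, 0x4860fe96661c0c665, 0x4860fe96661c0186, 102,
  0x24ae830286f94ae4cf35b72e0a00501, 0x121843b72e0a004f3, 0x48603ce460cc01271, 102, 90,
  0x92b83b171f2bef28d4066c6a092585, 0x12918883a806626418f5b53dbae95017f0b5f0cc01288,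
  0x92bbb8af94c04eab16a44683300487c,
  0x4c69225ae7cd819dc3f07a7f275bd1e20e876af7dd106e869b9a0d662f3ca54a0cc061c,
  0x4a4633bdb9d21936d4f916f6dde690b5ca7b4f594751, 0x12975067fe4b4175dd892f0653e837c8b40c24791385,
  102, 90, 0x129750054a8f83fa843cef7accc3156516aa39093e46, 0x4860c4aa39093e39,
  0x12183a87b940804f2, 0x24aee51884388094b40e8cc7794085, 102]

/-- Directions for adding edge number 12. -/
def searchData11 : List ℕ := [
  114, 0x48611054a0cc03c6, 0x48572711a0cc0127d, 113, 103, 114, 0x48611054a0cc03c6,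
  0x12183fad7c33004f4, 0x24a323c9409ae95000bed0091c0367d, 0x24a9d34573c425a48f68f906280a27e,
  0x24a9e83b7a9eded73d006f9062803dd, 0x8b26d87c6c40e5fdacddbcb2a534b063d6d4f6eba5405fc2d7c3300485,
  0x24a9e83b7a9eded73d006f906280ce9, 0x96931843676f4ddcd7ec2a0abebfda9f7d9c26cf8c2ab5a354dcc0f29,
  246, 103, 0x24a2aebb3e6d5a7a1d4edfde722e92, 0x485e70dfde722e86, 0x12180f391833004fe,
  0x92a77ca0669d747fb381b1a82509f3, 0x12180f391833004f2, 0x4856da242ff00127d, 0x121843b72e0a004f4,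
  113, 0x24ae830286f94ae4cf35b72e0a0050d, 0x121843b72e0a004ff, 0x48603ce460cc0127d,
  0x24a474ae3902f9af44217e93422a12, 0x48610b7e93422a06, 113, 0x12180f26b68240e75, 102,
  0x12182c69871248c76, 126, 0x24ae015093d489f5638405f3794994,
  0x1294f6861aa17df926a7d9a633ba1b97856c5f591153, 0x1294e2c2c129279b4afde7dfea5bc08ee4221dd22c52,
  246, 0x48572711a0cc0127e, 0x48610edcb8280852, 115, 245, 0x48572711a0cc0127c,
  0x1294fb14dbae44eedd4447cb5014ceba45cf478a0cd0, 0x12182f54f6de620f1, 0x48611054a0cc0185,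
  0x485726f24dcc0127e, 0x24ae05c7ca67cffd68475d7a091154,
  0x48da490084f9253248043bbcb129c17cda4da109595d, 0x48611054a0cc05a71,
  0x129750700a1ebda7a5906372500f1b13246960656251, 0x1290b94003308847c5e9a3f0d0103f01086960656251,
  0x1803d6752a8e7b37c5db2a9585ec551551fd5df2c30cee1a8522598f69,
  0x4a5e1b4b007fd50d7b361da913b58be1ae354dcc085d,
  0x939962e30603b182c38610ea2b451ad5137eb1c317acf920ae259985d, 0x12180f26b682404f2, 246, 103,
  0x129786bfdd283b36fc3214a22813926bc86965096fd1, 0x12170c9a59425be75]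

/-- Directions for adding edge number 13. -/
def searchData12 : List ℕ := [
  115, 115, 0x12180f26b68240501, 115, 0x12183fad6e4700500, 0x2472a6d7062decb4cf31ad6e470050c,
  0x1217feba53d384cf2, 115, 0x485ffae94f4e1820, 0x12183fad6e4700501, 0x485726f24dcc0128a,
  0x48611054a0cc07e7e, 0x129786d2c01ff71abb3e47808afe0f05e654a0cc03de, 115, 0x48572711a0cc01288,
  0x48611054a0cc07e7c, 0x129786d2c01ff71abb3e5760bee03f05e654a0cc03dc, 115, 0x120d550f1ce280500,
  0x24993895a26b2190d099cf478a0854, 113, 0x1215c9666e0a004ff, 0x485c887314f93c13,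
  0x48572711a0cc0128a, 0x48611054a0cc07e7e, 0x129786d2c01ff71abb3e5760bee03f05e654a0cc03de, 115,
  0x1211c565bb2c004fe, 138, 0x48611054a0cc07e7e, 0x92bbb8af94c0533af5d95283300dfe,
  0x129786d2c01ff842a9c587bfd01162f3ca54a0cc019e, 114, 0x1212e5a9268240500, 115, 115,
  0xd88e4384c54f4d9ece0b7cd987931bcff1a87de4710d, 0x242ff8ceaf08067ba784cbdf791e681,
  0x92a3ca082b6d0e907feb91833004fe, 0x121843b72e0a0050d,
  0x9229924769c1685365bd948581d6361a55e3052ff60c9c45612db8420, 0x48611054a0cc1327d,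
  0xd739f5195bf9f14c9c26810e81a01572ee460cc01205,
  0x22c9b61f1b1040bee9f84d9121cf7fec2aa5f72cb7f364f372e0a0050b,
  0x1b6abc8d53a5ea6fa4c10d396da6ce0f75ae3947853738ea0f7de51309, 0x12100798a49fc0500, 114, 114,
  0x121843b72e0a00501, 113, 0x4856da242ff001289, 0x48611054a0cc07e7d,
  0x129786d2c01ff71abb175a50e9f90d45e654a0cc03dd, 0x12180f39183300501, 115, 0x4860a6bc0e31c792,
  0x12180f3918330050a, 0x92bbb8af94c0458bcbdb91833004fe, 0x92bbb8af94c04eab3e495283300dfe, 115,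
  115, 0x4a46220ea019899063d6d4f6eba5405fc2d7c330048a,
  0x4a46220ea019899063d6d4f6eba5405fc2d7c330050e, 0x1215c9c46833004805,
  0x92bbb8af94c04a1b5f1446833004889, 0x92bbb8af94c05c5a64f95283301f889,
  0x25b0ec9d09ea835b1c4c8517214b92bffbdd6bfb858bcf295283301709,
  0x96931843676f528ca40ae412be1f59eb879bcacf9e6993e354dcc10e5,
  0x22c9b60ecb34d551493987b713addd7dd3706816b392249ef689646785, 0x48572711a0cc0128a,
  0x1217e7728f39912fe, 0x48572711a0cc0127e,
  0x4c68f6b1922bdffd2bb9cd22434d94394a7e6054fa1c8ac0d8535622fc834f906281cab, 0x1215c9c46833004fd,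
  0x4a5e1b2ad1324f0c3e48dc85fb7b933c817285fc475d,
  0x3e0faaa7d2dbe95a7e39bb1eab71b860302862b7e3922ff597d6d054de426354dcc2a29,
  0x24aee52de7cd0751e4ef0354dcc019d, 0x96c3b232e83c8533ef90c6de9be45119144f4d5c716c3d6354dcc061d,
  0x12183fad7c3300501, 114, 0x1215c9c46833004ff, 115, 0x4860ce372c0a2353, 127,
  0x24a44c500bd61f2b20c66829244e94, 0x24886d6756bd2823f51362bff0ce53, 0x48572711a0cc01289,
  0x48611054a0cc07e7d, 0x129786d2c01ff71abb3e5760bee03f05e654a0cc03dd, 0x1215c9c46833004ff,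
  0x1200e1424fdf965f3]

/-- Directions for adding edge number 14. -/
def searchData13 : List ℕ := [
  116, 0x1215c9c468330050b, 0x121844152833016ff, 0x1215c9c46833004ff, 127,
  0x21db96eff3850ee4ccbbc4683300487, 139, 0x24a9d4dde283a4800b341ee5020f2b, 139,
  0x121844152833016ff, 0x24aeee2be5301286e1ae54a0cc019f, 128, 116, 0x1215c9c468330050b,
  0x121844152833016ff, 127, 115, 0x12183fad7c330050d, 126, 0x12180f26b682404fe, 126, 127,
  0x1215c9c4683300509, 0x121844152833016fd, 0x1215c9c468330050b,
  0x129782440d611774ae0b11cff5610bda50f906281a5f, 128, 139, 0x4849ccb0b61c0c680,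
  0x4849ccb0b61c019f, 0x1215c9c4683300487, 0x1215c9c468330050b, 139,
  0x24a9d34573c42c7c22c0f90628182b, 0x1edb46c8863a72543248fb8c102e6eecf711defb7b933cd8354dcc3ba6,
  0x1ec7de88de739dfa930fe5122559b863d6d4f6eba5405fc2d7c330048a, 0x24a9ca575695084ab87f5a5628452b,
  0x23e9c4ea4aa50d55cbfd11a0cc0128a, 0x49e210906722204ff7603f8cdc4de17674f90628476b, 139,
  0x24a323b96067072000beb0b61c0368e, 0x92a7a0edea7b7b933caef90628596a, 0x1215c9c468330050b,
  0x48572711a0cc01206, 0x772a1fa1a6ca30913ad375682416806, 0x92a7a0edea7b7b933caef9062873e6,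
  0x21db96e013512cb4ccbbc4683300487, 0x4a46220ea019899063d6d4f6eba5405fc2d7c330048b,
  0x48572711a0cc0128a, 0x4a46220ea019899063d6d4f6eba5405fc2d7c330048a,
  0x24aeee2be5301162e9e111a0cc0120a, 128, 116, 128, 127, 0x9084e654722274ef2bc9fc37338901,
  0x36112021551f9c6c684a6806687931dcbb9183300489, 0x361c9517ce6abbcf118217a65cbf82c2c57a0dccebad,
  0x475f5ab093420368b, 128, 128, 116, 0x12180f3918330050d, 127, 0x24a5c153b2f2c44079d26fd2dbd99e,
  0x485d606fd2dbde1e, 0x21db96eff3850ee4cca8890bfc00486, 0x485d606fd2dbe2aa,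
  0x24a9c07fe60148b6bd74dcb8280cea, 126, 0x485ba363b599f6d2, 0x121843b72e0a0050d, 125, 128,
  0x485f18ef3a8bfd94, 126, 0x48611054a0cc03d2, 0xef8537b705ac229ba9c2cf787ed53e2dbcb3a8bfdac, 126,
  0x124fbc93461aad301cfb95518a0d4b7e42b8c34201aa, 0x471e7ff4a97001289, 0x10b376a92833004805,
  0x6d14d63344963131da2a2594fff447f100278994d62f3ca54a0cc05a5, 0x21db96eff38514cd7ae5f4a9700ea8d,
  128, 0x12564b21427974418283d8223b4833c847e9308a261e, 0x1b501fc46a8ab5cb0f35b72e0a0048a,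
  0x121843b72e0a0050c, 0x121843b72e0a0050c, 137, 0x44a3b00900af27e686ac0bf2d8305a38eb918330050d,
  0x12575fccf36fd0ff7d25b434461af2954900c34240a1, 126, 0x4851b5a407809cde, 0x48603ce460cc0128e,
  0x24ae8244023099a0a1acdcb828086a, 128, 0x486006221dd3a414, 0x911ec3cc72a23e53a03efa57246800,
  0x48611054a0cc0193, 0xf19a915dcd690de4926b5411a55d3c9ccfe1dd3a1ec, 0x11897a58e0eac43ff, 128,
  0x485c698aac3c085f, 0x12121cfbb90883b00, 0x121427896eb044cff, 0x10b376a92833004807,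
  0x31ba142da6a735f764e1c6f3d09a025088201dd23c2d, 0x4849cc86ba090f2b,
  0x24a9df3d61028eab46d353661c116b, 0xf09531362fcaa1b6dca83546dc431f5fbce9dd23c2a,
  0x24582bf7f4cb9a0b76d4359dd23e5e, 128, 0x481c13e94f526914, 0x1215c9c46833004ff, 127,
  0x3ce1e7f2b9db9dcca445e2a757e8d338644683300487, 0x47ea1fb8b8280128b,
  0x24a9df4d413668dfcf80b5b91c0aab, 0x24314f463a087ba785d1c5e7d4139f,
  0xf3b00d34e951e0736c7fbfdc0068fb456a1e7d40f2b, 0x24729c7ba367f15b2b45c5e7d4115f, 128, 116,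
  0x120d550f1ce28050c, 125, 128, 116, 0x1215c9c46833004fd, 125, 0x21db96eff3850ee4ccbbc4683300485,
  137, 0x24a9e82b9a6b03c2ab5a354dcc0f29, 128, 0x485c2f5a45662a94, 0x1215c9bc9373004ff,
  0x485e1b1b70cc029f, 0x21db96eff3850ee4ccbbbc937300487, 139, 0x24a9df3d610288f7ab48b5b91c0f2b,
  0xbd88b883e0d6a64b9e3887fadc916dd891aba09332d, 126, 138, 0x1211a3e9d2998defe,
  0x485a918119f7ac9e, 0x485c259766147d5f, 0x485c259766147f93, 0x4820ae056615579f, 116,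
  0x2472a6d7062decb4cf31ad6e470048b, 0x12183fad6e470050d, 0x91ca9b5c18b7b2cf4e0fbd0cc8f4aa,
  0x12183fad6e470050d, 126, 0x1212541cf95ed1ffe, 128, 0x480b4d48b7e48254,
  0xd89b77f1505d030acc98c2241238342c2b58c100ded, 127, 128, 0x482fa963d7901b54, 128]

/-- Directions for adding edge number 15. -/
def searchData14 : List ℕ := [
  140, 0x48611054a0cc03e0, 140, 0x48611054a0cc03e0, 140, 272, 140, 0x48611054a0cc03e0, 139, 271,
  138, 0x48611054a0cc03de, 0x42c3f161a0cc01206, 0x12183fad6e470050e, 138, 0x11fa8844537300487,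
  141, 0x12183fad6e470048a, 0x12183fad6e470050e, 138, 0x12183fad6e4700489, 0x47ea21114dcc01206,
  129, 0x11fa83dc99870050c, 272, 0x11fa884c28330050c, 139, 271, 139, 271, 7, 142, 139, 139, 139,
  271, 0x42cdc905b91c01208, 0x1215c9bc93730050e, 7, 0x48611054a0cc05a8b,
  0x92bbb8af94c04eab3e495283300e0b, 0x129786d2c01ff7aeb504e7c5901162f3ca54a0cc01ab,
  0x24a9df3d6102858be19cb5b91c07e7, 0x876e3806e872680ef592d6e4703187, 140, 272,
  0x1297824c0ae698b04b13a9472288f7ab48b5b91c0f2b, 0x12183fad6e4703b8f, 140, 0x48611054a0cc03e0,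
  0x42cdda854dcc01208, 0x1215c9c468330050e, 5, 0x48611054a0cc05a89,
  0x92bbb8af94c04eab3e495283300e09, 0x129786d2c01ff7aeb504e7c5901162f3ca54a0cc01a9,
  0x24a9e82b9a6b0056e1ae354dcc07e5, 0x876e5b804d44ca7af5d8d537303185, 140, 0x12127321ae8254990,
  129, 0x129786cab44c8d678b4b47808b03c2ab5a354dcc0f29, 0x1218440d537303b8d, 129, 140,
  0x48611054a0cc03e0, 140, 272, 0x42cddaa4a0cc01205,
  0x1128ec02402bbdd71b83a7d11013aacf9254a0cc0629, 129, 140, 0x48611054a0cc03e0,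
  0x42cdc905b91c01208, 0x1215c9c468330050e, 0x47ea1fb8b82801207, 0x48611054a0cc05a8b,
  0x129786d2c01ff6868f3ba44d791b58c5e654a0cc03eb, 0x858bf7eacbbab7bbaaaa879f501f87, 140, 272, 129,
  0x1297824c0ae699443fd45921966c4b992cb5b91c116b, 0x12183fad6e470448f, 140, 0x48611054a0cc03e0, 8,
  0xeccb2af37933cf2e508d3e36c4367b4da1c7b63aeee, 7, 0x48611054a0cc05a8b,
  0x129786d2c01ff686cb83a7d1100f1a9c9061840c03eb, 0xd74141b220dd2afc5bf17a6e8aafcdef847ce1effee,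
  0x1215c554d98701f87, 0x875a2005bd5e1f4ecded4d98703187,
  0x1128ec02402bbd4326c307d6d01162f3ca54a0cc0127, 140, 272,
  0x12918cf77a47e48d3dc4bcd6ebcb4fda2317974213ad, 271, 140, 0x11f9da3185d080e90, 140,
  0x48611054a0cc03e0, 272, 129, 140, 0x48611054a0cc03e0, 0x42cdd92cb82801207, 0x12180f3918330050e,
  0x12180f39183300486, 138, 0x12180f3918330050a, 139, 0x11c4d8a176da40e8f,
  0x1a95ea2e62e2fcb6930db203420aaa, 0x46b26fb203420a9e, 139, 6,
  0xe006c2e12771636038e7680ab072612bef3f40942ee, 0x483f6fdfd409452a,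
  0x1128ec02402bbeff0504e7c59015f1480ce995910f2a, 0x42cd073460cc01205, 0x121843b72e0a0050e,
  0x1187570cf0fac0509, 0x121843b72e0a00488, 0x92bbb8af94c040fc179372e0a0050c, 0x11cd678f67b88fa09,
  0x121843b72e0a00488, 0x35e4067da97001205, 138, 126, 270, 0x876caf1a553970cf12a8cf223c950c,
  0x242e9b820e1afd8b17314fb14c7faa, 0x1a8af6a813c819ed55f4f7e97003606,
  0x21db96eff3850ee4cf0139183300486, 0x10b376a92833004806, 0x11c79ffd2a5c00486,
  0x483fd1a50a091a6a, 0x11c79ffd2a5c0050a, 0x12180f3918330048a, 140, 272, 0x11fa884c28330050c,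
  129, 140, 0x48611054a0cc03e0, 138, 270, 0x42cddaa4a0cc01205, 137, 0x121066f0ba8250a0a,
  0x48611054a0cc019e, 0x42cdd92cb82801208, 0x242c47b39e56c2b7cc4ec26a0913ae,
  0x245dafbf1eb8075c0201fbea093726, 0x48611054a0cc05a8a,
  0x126e59bb490e9ab0314d0424900f1aedbdd44dd240aa, 0x24a9c07fe601454af3c8dcb82805a6,
  0x1128eba1b111a0a3922ac54c475da07769d44dd24fe6, 0x11fa83d21a824050c, 272,
  0x128f725fe2d4a9ce6fb0c9395de216850dc2ea0949aa, 141, 0x118addf2d2a339d90, 0x42cddaa4a0cc01207,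
  0x1128ec02402bbd4326c307d6d012859f13daff32086b, 129, 140, 0x48611054a0cc03e0, 140,
  0x48611054a0cc03e0, 0x11d7d6ac24d080489, 0x11d7d6ac24d08050d, 0x48325be5078cd5ac,
  0x12180f3918330050e, 0x42cddaa4a0cc01209, 128, 140, 0x12180f39183301790, 129, 140,
  0x48611054a0cc03e0, 129, 0x1d951970086d2e3671f7c1b63effec, 0x468745c1b63effe0,
  0x24a323c9409ae95000bed0091c0360b, 0x48572711a0cc01206, 0x48572711a0cc01206,
  0x1215c9c4683300487, 139, 0x92bb64d7795576801b94468330050b,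
  0xd835dd98eadeefb4e6d648591183afc646d070aa5eb, 0x1215c9c4683300487,
  0x876e5b804d44bccbcf295283301687, 0x1e042d8ac46f71f5ceafc4683300487,
  0x92a7a0edea7b7b86201a3f600a546a, 0x876e37c7d887d9064902c1fb8eb527, 8, 0x11f8f23ca9ed80487,
  0x42b69700b61c0a27, 0x1df3c8c7a2ba300fcc3111a0cc0120a, 0x1215c9c4683300487, 0x4685b1dff7b0f8a08,
  0x1215c9c4683300487, 0x78277d6d7b6c4cd427e44683300487,
  0xf3964cb4dede00e3f00651aed945870ac0d3c3da1eb, 0x92bbb8af94c040f9d33034f0f68f0b,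
  0x7826cf8511457d4ca4d44683300487, 0xf394f22e2d72bcb19e6d9372c9680bd77bc8d0993eb,
  0x4a5e091035845dd191a81056c88a22c95b212e0ab36b, 0x24a323b96067072000beb0b61c0360b, 138, 139,
  0x1057b3bc7a3697e87, 0x92bbb8af94c0401fe2eb6bbe14116b, 0x84864068e7079d7b24595283300e0b,
  0x129786d2c01ff6853d69792d41abeaf50654a0cc01ab, 0x49e210906722204a50b1c7a9863b9d04ff49062822eb,
  0x120aa1fc591a04f0a, 0x46dc0c855a0903608, 0x1122d86bdf9957035279126524f56818faf2a7b625ad,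
  0x1215c9c468330050b, 0x42cd9f8b032801208, 0xf395064baaea75ad8102efaee1336875ca1806611ee,
  0x48572711a0cc01206, 0x8b265d61b68d5b2693da950082f0cca9dc558197faf779e2a3f5fe727,
  0x42cdb149062801208, 0xf3973c4a54987a852bbccfb11d0c50d4a589d7f0c2e, 0x39c5e86764b285e07,
  0x39c5e86764b28a68b, 0x92bbb8af94c04a1b86b95283300e0b,
  0x129786d2c01ff71ac04447cb501162f3ca54a0cc01ab, 0x12977c3321cd551a82365c85245b3d3c44f9062873e7,
  0x12977c3321cd551a82365c852445929458f9062849ab, 0x12977c3321cd5ae216c28cb63575929458f906281eeb,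
  0x876e07e7b2a9ff579e744683300487, 0x1128e162a1d91c67fedf2093795b37a90f49062873e7,
  0x129786d2c01ff4c819d595e9ca8b37a90f4906281e67, 140, 0x12084854475fc6e90, 127, 271,
  0x12977c3321cd5926337abc5ce46332fbc42083c88ee7, 0x4860e6f9062871a8b,
  0x1294f0753d5bade9ce9d2289500f1b17d8f90628332b, 0x111cedc9b3a9855ef9c9e26c90103f05bcf90628332b,
  140, 0x48611054a0cc03e0, 0x42cdc8e69dcc01208, 0x1215c9c468330050e, 140, 272,
  0x42cddaa4a0cc01208, 0x928c8ee5819cc5440c1b9c6824050c,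
  0xf9a844198aa34abbcf6c6f344f3c6632545650a652c, 0x12170c9a594299c90, 129,
  0xf93cbbab2900282b4516b2e85fb7c1717a5e65a72ab, 0x1212fc6520a45c98f, 129,
  0x96c35c4e5f1ee7f2a12998af4690b4802080af2a4983914f90628626b, 0x1215bafe00ca1888f,
  0x11f945d7e12f04490, 141, 0x11cbbd834d2d4b68f, 0x42cddaa4a0cc01206,
  0x1128ec02402bbd4326c307d6d0128509c5c69c48086a, 129, 0x83c1bfe192c9520b, 0x48611054a0cc019f,
  272, 0x42cddaa4a0cc01208, 0x11fa83d21a824050c, 129, 0x6558e455cbabec0c, 0x48611054a0cc01a0, 272,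
  0x42cddaa4a0cc01208, 140, 140, 0x42cdb46ee50201208,
  0xf3a26c00f9192c1555e719c1cc342e0d721c77b2d6e, 0x245dafbf1eb882845e31fbea0a4527,
  0x48611054a0cc05a8b, 0x126e59bb490ed91b729081b7900f1af88a89834d4eab,
  0xf91241a49266b33cf14419510103ee66e89834d4eab, 0x24a9d4dde2839ff053a41ee50205a7,
  0x1128e231a27bac04d033c038f4d114223689834d42e7, 0x11fa18a211decf30c, 0x1122b96b9f82ca290, 129,
  0x128f725fe2d4e839b0f740df813e8707edc2ea0a57ab, 0x121066f0ba8295d8f, 272, 0x42cddaa4a0cc01208,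
  0x11fa83e47c330050c, 129]

/-- Directions for adding edge number 16. -/
def searchData15 : List ℕ := [
  141, 0x11fa83e47c330048b, 141, 8, 0x21db96eff385103f05e654a0cc0368, 141, 141, 9, 141,
  0x1215c9c468330048a, 140, 141, 10, 8, 0x21db83925b69cecc65e654a0cc0368, 9, 141, 141, 8,
  0x12184415283300e0c, 0x24aeee2be5301162f3ca54a0cc01ac, 8, 0x21db96eff385103f05e654a0cc0368, 141,
  141, 141, 0x11fa83d21a824048b, 141, 8, 0x21db96eff385103f05e654a0cc0368, 141, 141, 141, 6,
  0x21db96eff385103f05e654a0cc0366, 0xbeea94bd7120048a, 139, 139, 141, 141, 141, 8,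
  0x21db96eff385103f05e654a0cc0368, 141, 0xf11ef92b89ec048a, 141, 141, 0x1215c9c468330048b, 140,
  8, 0x21db8df1f621f30f05e654a0cc0368, 0x10b376a9283300489, 141, 140, 141, 141, 139, 9, 141, 141,
  8, 141, 0x245e6b28e37ff4159daad6392440ac, 141, 0x429eef26392444a8, 9, 8,
  0x21db81f9ecaa5238c5e654a0cc0368, 0x1215c9c4683300487, 8, 0x1215c9c4683300487, 8,
  0x21db78fbef473508c5e654a0cc0368, 0x4849ccb0b61c7868, 0x2454fcce000e520bf7feb0b61c7fac, 141,
  0x41992cfe69121496f79a1568240489, 0x11b7032156824048b, 0x48572711a0cc07e09, 8,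
  0x11f257b497de5880c, 141, 0x10ab1261c8f511289, 141, 0x482864eed3c825ac, 8, 0xf131c720ef68048a,
  0x3c772bdcfcb0e8e7, 0x24aeee2be5300f1a54893cfcb0edeb, 0x1ea52dcb87f37e8d39293cfcb0edeb, 7, 139,
  139, 140, 11, 0x48611054a0cc0a207, 0x45dc512895b6c9ec, 0x1215c9c468330048a, 8,
  0x48325fd083c8e06c, 0x7a3e188e46a8186c3f5ef2f3c1fc88, 0x1215c9c468330048a, 0x1215c9c468330048b,
  8, 0x2f3aca46189b3560a, 7, 7, 0x1215c9c4683300487, 0x12184415283300d87, 8, 0x1215c9c4683300487,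
  8, 0xf118345a14e654ac5613e5bcf655b938f6c44d7596a, 8, 0x11f8f23ca9ed80487, 0x12184415283300d87,
  0xc38dd1066b99027750292b0bced921e7a8caf590eab, 0x12125a1e88f51ea89, 7, 7,
  0xf73dfd2f99a08e0f79ed80c6a7f6e8f8ad3e087086b, 0x121781f6eff699988,
  0xf30102c56a2e73846e63f2c561d66f8bbc417dae8e7, 0x2429e08caab720ddcb175b17db0ce7,
  0x777673bebf9c900de014468330048a, 0xf373cefd8e998f69d4719e3bc20fc4a6ff08702b0a8,
  0x876e5b804d44b2d30e27d083c93e68, 0x777538597215eef946c4468330048a,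
  0x914216d72171dd15efa5111c0b2e88, 140, 7, 0x12184415283300e0b, 0x24aeee2be5301162f3ca54a0cc01ab,
  0x1215c9c4683300487, 0x12184415283300d87, 0x1215c9c4683300487, 8,
  0x7776500c9145eaa7f3344683300487, 0x92bb64d779573a1418444683300487, 0x4860feb5f0cc05a07,
  0x1215c9c468330048b, 7, 8, 0x6954d707f00a16d, 0x10b376a9283300489, 141, 0x34b4535a8a0af0ad,
  0x10b341cd183300489, 141, 0x46e6945c8a0aee6d, 0x20f06c83078b9f2c, 7, 0x42cddaa4a0cc01207,
  0x12180f3918330048b, 139, 9, 141, 0x11d7d6ac24d08048b, 140, 0x1ab616cd4c4f31732a01888a0b0b29,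
  0x10371be22282c3589, 0x10b376a9283300489, 0x2490270b520d1e5406f42d27a421ad, 0x10b376a9283300489,
  141, 141, 7, 0x21db96eff385103f05e654a0cc0367, 0xd78ff18ffcc8048a, 140, 140,
  0x23ac136f8490bcfcfb44b5e78c286d, 0x11fa83d21a824048b, 0x23ec436cfbaf34971f00428c1e11ed,
  0x1215b6890bfc0048a, 0x119584804c6f2080c, 141, 10, 0x1215b6890bfc0048b, 8,
  0x21db96316ebc5b58c5e654a0cc0368, 0x1f95add765dc12c890416aea5ed36d, 6, 138, 138, 5,
  0x21db96eff385103f05e654a0cc0365, 0x21db96eff3851162f3ca54a0cc086d,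
  0x1128ec02402bc026ee8627ba10137b3bd440d8817f29, 0x876e5bbfce145c5a64f95283303b0d,
  0xc91f92fe09ed8a15fc654a0cc01aa, 0x10b376a9283300489, 141, 0x2b94c782ec4eebad,
  0x11fa884c28330048b, 141, 0xae429946b13be30d, 9, 0x1eae81421d60271c310fe55abcc5ee,
  0x1209f4e40baef770d, 0x12180f3918330048a, 0x12184415283300d8a, 0x11c79ffd2a5c0048b,
  0x2019667c26269b8a460ef84a8c59ec, 6, 0x24aeee2be5300f1adc1c60bbeb4bea, 0x11c79ffd2a5c00486,
  0x12184415283300d86, 0x11c62572565c82887, 0x42cddaa4a0cc01207, 0x10b376a9283300488,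
  0x249e14c5914b5f2d48d3154a0910e6, 0x872ca2cbf75c95d4926c5528245586,
  0x241a9f90ea1eef143e0326add21566, 0x6e877f411f0914fbc5ad26add217a6, 8, 0x11cfbd11d2824200a,
  0x249e14c5914b684c9c7860bbeb6b6d, 0x4840a5154a090cea, 6, 0x12184415283300e0a,
  0x24aeee2be5301162f3ca54a0cc01aa, 0xa8ab6d688bba3f88,
  0xd872cc90c7b029f5b28c10480192ddd7f212dd26ae6, 0x4f7926aa388495f7ff1372e0a0048a,
  0xa8ab6d688bba5a85, 0xa8f86ef5063e9588, 0x10a926a52429d8fbca36a8a15d2f3e17e69181bd3f6a,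
  0x1568d2f4f1f92204c9022d418faa69, 0x121843b72e0a0048b, 0x92bbb8af94c0449144b7a492dc4525,
  0x1187570cf0fac048b, 0x46e6945c8a09842a, 0x121843b72e0a0048b, 137, 5,
  0x21db2bc6954e4c3f05e654a0cc0365, 0x4562258acfdc88a6,
  0xad093760e35ee4da801a7a6b6bf9bef0acf231596ac, 6, 0x12184415283300d86,
  0x24aeee2be5301162f3ca54a0cc0126, 0xd70d25ca5644048a, 0x6983be12b905bb1bc02d2eea9692e, 140,
  0xd763a43b6da4048a, 140, 140, 0x12180f3918330048b, 0x19286ae7dd9f1b40972f3e90efc16b,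
  0x194ee98f49282366, 0x12184415283300e0a, 0xcd3a726645dc5e883ae54a0cc01aa,
  0x1844c233e5c0165dfb2a5143420366, 0xd7d951450d081686, 0x12180f3918330048b, 139, 7,
  0x21db96316ebc5b58c5e654a0cc0367, 0x10b376a9283300489, 141, 141, 141, 0x10b376a9283300489, 141,
  0xf12839085d08048a, 141, 141, 141, 0x226293c9250cb0fe128c0bc1e4e7ad, 0x43d7837c7be008e8,
  0x24aeee2be5300f168e757c7be004ec, 0x22623b4a4c8419c545157c7be004ec,
  0x876e5bbfce143b93187089f2a71e68, 0x1215c554d9870048a, 0x7994e473d93328513c3f6b6cb05b28,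
  0x2456a7d0ad8889b7d778b3040c182c, 141, 0xf231e24bd088af88, 8, 0x11f9679861030048b, 8,
  0x12184415283300d88, 0x24aeee2be5301162f3ca54a0cc0128, 0x10b376a9283300489, 0x1208e0c014b9d830d,
  0x13c2ded29bdb77ad, 0xa02b06c72f4c00e6db02caa8002ad, 9, 141, 0x10f5d92a5ffde230d,
  0x42cddaa4a0cc01208, 0x11fa87ee2e0a0050c, 0x1f68cf34e0b3bc6e17bbae04dd9aad, 8,
  0x10b372416e4700489, 0x1215c9c468330048b, 140, 8, 0x21db8e01ba1c957405e654a0cc0368,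
  0x10b376a9283300489, 0x4f0c13259c050c0d, 0x481ab9c51f50212d, 0x1d899cee415b84b20f6132ea0ac0e5,
  0x209e415f9c65f81dd90d32ea0ac0e5, 0x1f11dc378d00795c98d2937fc8bf2d, 9, 141, 0x4f0b0ad7eb516d0d,
  0x10b376a9283300489, 0x1f131db3a7a4cd581c88e43fc8d5ad, 0x47fae3e90ff08dad, 141, 9, 141, 141,
  0x876e5bbfce143b93039860d78a0ea8, 0x77d4b4c53742a9a7e594468330048a, 141, 140, 141, 8, 8,
  0x10b376a1537300489, 0x1215c9c468330048b, 140, 8, 0x21db96e013512e0f05e654a0cc0368,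
  0x10b376a9283300489, 141, 0x233b1b8b5cea4889406ade30cdd22d, 9, 0x1eaed7fdc2bfd539399706f0cddfae,
  141, 0x876e5bbfce143b9316aa6d6e97a268, 0x1215c9bc93730048a, 0x1804f7dae3f9680d,
  0x481abf6a4297e42c, 0x457a582e1eb78fed, 8, 0x4474f5e3f509f6e8, 0x10b372416e4700489,
  0x1215c9bc93730048b, 0x1eaec4a48384199e4914d9c8cdbdec, 8, 0x21db8e01ba1c957405e654a0cc0368,
  0x46e4ff1aba096b6d, 0x481a3a91a2144927, 0x24aeee2be5300f1ad12c91a2145deb,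
  0x248b0796b8fd4188fb9091a2145deb, 9, 0x1ebfbd26f9c5cda52498eb40cddfae,
  0x21d4ccc1b30702c99428c280cde8ad, 0x42bc30c6fc251da7, 0x24aeee2be5300f1b065876fc2522ab,
  0x21d2a3286c9144cd498476fc2522ab, 0xe710101493680487, 0x189f4f09a9d796136cd4a2fb0a21ad, 139, 7,
  0x12184415283300d87, 0x24aeee2be5301162f3ca54a0cc0127, 0x46e1c23b4a67096d, 0x3e4f2f579fdd0e67,
  0x24aeee2be5300f1710462b9fdd1a2b, 0x1f9467d46ce4259231be2b9fdd1a2b,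
  0x1fd5d244bf3917a3242bfdcc115f6d, 9, 0x45d7794408d18a2d, 0xf931050b1393d10d,
  0x11fa884c28330048b, 0x1fd7d184b591bbba7ea4fbbe14b5ad, 0x205b5f655f2b9667deab2fcc11956d,
  0x11fa83dc99870048b, 0x205bfc293087c196b2db76f8da1cad, 0x485c30b2db0a96ad, 0x2fc4fb2e7a3534a09,
  0x8501675437ec9cb4620c4537300487, 0x5cbfea843206cfeab8a2d6e470048a, 0x2fc4fb2e7a353da06, 7,
  0x44b9492d2a6820eb, 139, 0x12183fad6e470048b, 0x447238bb91f816ea, 0x12183fad6e470048a,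
  0x12184415283300d8a, 0x10a7be38973680487, 0x188964ae8aaf3218d9def38f0a6e2e,
  0x22e5196fa80840b27eeeba42ca2a2b, 0x11fa8844537300487, 0x12184415283300d87, 7,
  0x161596332501795c438aaa3120fb6e, 139, 0x12183fad6e470048b, 0x446d3292e4de05ea, 6,
  0x21d690ff88f3e03f05e654a0cc0366, 0x10b376a9283300487, 139, 0x21d690ff88f3e7168f5511a0cc13ad,
  0x481ac83028d103e7, 0x112660445bba0fb601001cb9e03492827e3028d10b2d,
  0x248b4f5d4d02cadedd0a3028d10b2b, 0x10b376a9283300489, 0x20269a014d7cf40f5ac84c34a56a2d,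
  0x47674cb58c11c92d, 0x4807520d8024e568, 0x24aeee2be5300f1ae6882b1ca1e42c,
  0x2481724f7ac60c8aee702b1ca1e42c, 0x10b376a9283300489, 141, 0x10b376a9283300489,
  0x83c0afdd823e7b0d]

/-- Directions for adding edge number 17. -/
def searchData16 : List ℕ := [
  142, 9, 10, 142, 9, 9, 10, 9, 9, 10, 142, 7, 0x10b0fc58683300487, 7, 7, 6, 10, 142,
  0x42c3f161a0cc17a7, 0x42c3f161a0cc17a7, 9, 9, 7, 6, 6, 7, 6, 10, 142, 7, 7, 0x48611054a0cc0127,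
  10, 7, 6, 0x12183fad6e4701f89, 0x11fa884453730168a, 7, 9, 9, 142, 9, 9, 0x48611054a0cc0129, 9,
  10, 9, 10, 0x44fcfc82f1753689, 9, 141, 7, 9, 9, 0x48611054a0cc0129, 9, 10, 0x10b372416e4700489,
  9, 8, 9, 9, 0x42c3dfa3661c0129, 0x4e5ef1694d51ab8a, 9, 0x45a2bace1bca34e9, 0x448a734d33948169,
  0x42b696d6ba090a29, 0x42ac9bd57f590ced, 142, 8, 8, 0x249e1da3ce46bc8a635df9812f8ca9, 10, 142,
  0x42b696d6ba0910e9, 0x42b696d6ba0910e9, 10, 142, 9, 0x10b376a1537300489, 9, 9,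
  0x4831b9a3d78a062d, 8, 9, 9, 0x42c3f1424dcc0129, 10, 9, 9, 9, 9, 0x48611054a0cc01ad,
  0x429e83f3d78a1329, 0x42949a91848a15ed, 142, 10, 142, 8, 0x2491ea37c1e37a879d0260d78a0ea9, 10,
  0x47c820af7a09692e, 0x4831b9a3d78a1569, 0x4831b9a3d78a15ed, 0x429e83f3d78a1329,
  0x429e83f3d78a1329, 10, 9, 142, 9, 0x48611054a0cc01ad, 9, 0x48611054a0cc0129, 142, 9,
  0x10b372416e4700489, 0x44b9c21a1bd922e9, 9, 0x18cbe6eef45a572d, 8, 9, 0xffa525c72d4fac89,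
  0x4680f723490eeb29, 10, 9, 0x47d629f4e8c803ee, 9, 10, 0x4695c524dbda142e, 9, 0x48611054a0cc01ad,
  9, 0x48611054a0cc0129, 142, 9, 0x44362bfca76da9e9, 10, 0xfa60ec463322cb89, 9,
  0x147959935a4f9a89, 0x5a0e76fca26e6a9, 10, 0x73ead484318fb58a, 9, 9, 0x48611054a0cc01ad,
  0xbac2b174b12f429, 9, 8, 0xddd2e82bfab8af88, 0x21cabd79a33341c1ff8f857f590a29, 9, 10, 142, 10,
  142, 0x4849cc86ba091c29, 0x4849cc86ba091cad, 0x42b696d6ba0919e9, 10, 142, 9, 10,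
  0x24249dc867b7142e, 10, 10, 142, 9, 0x10b3764b2e0a00488, 0x465658f99a8b7628, 8,
  0x3a01a31e1a8c286c, 7, 0x485e2222478bb9a7, 140, 0x47b0b00d8fdc0867, 7, 10, 142, 8,
  0x48611054a0cc01ac, 8, 10, 142, 8, 8, 0xc8c2bee57a80c38a, 0x103019169973ccc88,
  0x21cfbf02f231a2729f40189f794928, 0x10b341cd183300486, 6, 6, 138, 5, 10, 6, 6, 5,
  0xcfa4221097ca078a, 0x472acfcc5be249aa, 0x9bf65e8333acc18a, 0x450b5063fa706666, 5,
  0xd79019f6a5c00d8a, 6, 0x471e5a81b14c746e, 9, 10, 142, 8, 0x48611054a0cc0128, 8,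
  0x11cfbd11d28240487, 10, 0x876e5bbfce143b933acf508a8c1827, 8, 8, 10, 10, 0x345f018000cc0128, 8,
  0x1b5ee17e4d87c8bbef425a65cf866b, 0x21db96eff385227de42654a0cc29a8, 10, 8, 0x462b660d478c0627,
  0x30be706072176feb, 142, 0x33d26e8e5ac90369, 0x33d26e8e5ac90369, 0x228eb3575393e6e, 10,
  0x203b7b5bb21fa66e, 9, 10, 142, 9, 0x473f1784aa09692e, 0x10b376a9283300486, 6, 10,
  0x11cda55ab185af6e, 0x46959eb365fae4e6, 0x46959eb365fae56a, 6, 0x48611054a0cc0126,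
  0x10b3764b2e0a00489, 9, 8, 8, 0x441aacac91a4cde8, 9, 0x454f59ccdd0461e9, 0x454f59ccdd04626d,
  0xf262c46da825b48a, 142, 8, 0x1df2435442d652b44c6de66a0985eb, 9, 10, 142, 8, 0x48611054a0cc01ac,
  8, 0x10b376a9283300488, 8, 10, 10, 142, 9, 9, 8, 10, 0x194f16d8339330ee, 8, 9,
  0x48611054a0cc01ad, 9, 0x48611054a0cc0129, 8, 0x3a01a31e1a8d1b6c, 0x345e3d1242fb4a2b,
  0x461a9895cb0b2f28, 10, 0xc991b9ec0fc0628a, 8, 0x462b77cb4a8d1ae8, 10, 9, 0x48611054a0cc01ad, 9,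
  10, 142, 9, 7, 7, 0xddb45720131d5187, 0x341e7d0431b0e0609, 0xddb45720131d6c86, 8,
  0x3af4f02a9eab8aeb, 0x116755831402b4988, 9, 0x1c1cd999b0b1ae7cbd91c06b66d6e8, 8, 7,
  0x10ada158818701689, 0xdde37193a039fc87, 7, 0x1215c9c468330048b,
  0x1b0c42340e352ca03a7abbece39aab, 141, 8, 9, 9, 141, 9, 0xdd90e8b1f69fac88, 9, 8,
  0x34361d13b9c0d388, 9, 10, 9, 0x42b69700b61c0129, 10, 7, 0x48611054a0cc0127,
  0x10a545e07a4900487, 7, 9, 0x10ada5c02d8701689, 0xf6438763a6b5af89, 0x461e2ad8b70bed69, 10, 9,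
  0x3e20d7bea913eb8a, 0xf5ed0513e2167589, 8, 0x1df3cc80313d8b6556f84c4702252b, 7,
  0x168ba4d70741e51b5fa3069cb0cdeb, 0x168ba4d70741e7633b6b069cb0c2ab, 8, 0x3701520b11f1a66b,
  0x8f7300f6382b528a, 9, 0x103e7cba0f1b37a9, 7, 0x12184415283300d87,
  0x24aeee2be5301162f3ca54a0cc0127, 0x16967e1c7ba2cfa60198908d0a3e67, 0x8dbb86abfac91287,
  0x21f5c4885271d88a, 9, 0x11ff6ca679bbd369, 8, 8, 0xe276b59e19229988, 0x442c4fd679bbfe29,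
  0x483224d6392461e9, 0x483224f58c2464ad, 0x2133ed71389ca8df48b0ce037b1329, 9,
  0x23220ab0f755015e0b925f404baaea, 8, 0xe25e8fe372c52f88, 0x429f00e43c245d69, 0x429505e33924602d,
  7, 0x168e04d53511d32dc58bedae7dc32b, 0x1dc7f352e454fe18eaa96b8648bce6,
  0x1c6a9fa87b8aa990081877b6c59fa6, 0x24aeee2be530102f437fedae7dc567, 9, 141, 9,
  0x245630ebb88666ed, 0x1eb91066df8dfbdfeb7f274556bf28, 0x44741174a59b62ec, 141,
  0xe1e66d486afc1888, 0x47c4d36a9d0a40a8, 9, 0x442f04740556c3a8, 9,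
  0x1eb9122362e089f38299a33c3d506a, 9, 0x479d085ca5b713a9, 0x3abf1996c8fa52a9, 0x483f7f3723d46fed,
  10, 0x47e8e692c8fa60ae, 0x4141fed1d0677fa06, 0x21bed23e51e041d3b9267a23d47f28, 10,
  0x2c97972c7a7091ae, 0x48283b93392473ea, 142, 0x1b5a010bc43d2329809d93392473e9,
  0x249deafeab253d842c35725f798829, 10, 0x249deaeecaf1280eea8dd083c87f27, 10, 7,
  0x1f172930dd9e2f4e381c31d3c88167, 10, 0x25d72075651e6bee, 0x21cf99b3240b547961125ad0d4ac29,
  0x1f31ac1fe39ddaa131c65ad0d4a9e9, 0x24a2f0ef15b687c89e75ab3e162aa9, 0x10b367e2c0ca00489,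
  0x48497a18d3d4bbe9, 8, 0xe986a0e353090d88, 7, 0xbb0e7608b1c91f89, 0xdee87022a03efa87, 7,
  0x10b36c52418a00489, 0x4849687a23d4c2a9, 0x429f2a2083c83069, 0x429f2a2083c83069,
  0x205c7cd23872c9e1f3607e64b222e9, 0x243ff211bbdba4d2899eb60968006a, 0x4582333181dd4529,
  0x4582333181dd45ad, 0x473588151248baa9, 10, 0x479dbb82c97ee82e, 9, 0xdf9b8841a19fc28a,
  0x10a7ca8820f213f89, 10, 0x47a048ea1d7f716e, 0xbe13c35cf1a4629, 0xbe13c35cf1a46ad,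
  0x42b632ca23d471a9, 0x42b632ca23d471a9, 10, 10, 0x45a2b4a5df86aa6e, 0x44d3fa7da17f1269,
  0x44d3fa7da17f12ed, 0x44d3fa7da17f0de9, 0x45c6e6fba767922d, 0x174c6eb5a17f032e, 10, 142, 9,
  0x10b37239a77300489, 0x483236943c24eb29, 9, 0x483236943c2506ad, 0x3b44523f600baeeb, 10, 142,
  0x48283bb28c249369, 0x48283bb28c2493ed, 0x429506028c2497e9, 10, 142, 0x10b376a9283300489, 9, 10,
  0x47c77fe72525b36e, 10, 10, 10, 142, 7, 0x48611054a0cc01ab, 7, 0x10b376a9283300487,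
  0x20eea5da84b4baa7, 10, 10, 142, 10, 0x45e1fd2ee0269c2e, 0x10b376a9283300489, 9, 10,
  0x459c319d94bd2bae, 9, 10, 10, 0x45e3ca3c8826932e, 10, 0x45034365ca2723ee, 0x10b376a9283300489,
  0x453b00503c277b29, 0xca3dc84a4439dee, 0x1f964bedb8bdd3a9b7767610026129, 10, 10,
  0x443604f20f1b41ae, 0x4590661987f28be9, 0x4590661987f28c6d, 0x2c0cd6fa21b9e469,
  0x2c0cd6fa21b9e469, 0x10b36d1bb94080489, 0x45036492fab8f529, 0x1df241b1ee0a56d9a246ad034d866b,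
  0x46e3adfce0261da8, 9, 0x4481bd76f9eec7a9, 0x4481bd76f9eec82d, 0x245cd96c624b27ed87a6e6b70b506a,
  0x1953985374bb50ed, 0x47bf1c7b6a0a946e, 8, 0x1df2435442d6ca70def1e66a0a78eb, 10,
  0x43ede6ea97776cee, 9, 0x48611054a0cc0129, 10, 10, 142, 0x10b376a9283300489, 9, 10, 142, 9, 10]

/-- Directions for adding edge number 18. -/
def searchData17 : List ℕ := [
  10, 0x48611054a0cc29aa, 11, 10, 0x48611054a0cc2bea, 11, 0x48611054a0cc2e29, 11, 10, 10,
  0x1122b5ef6cf5d6a, 10, 8, 9, 0x48610edc48c8ac29, 0x412962aec8d90a2a, 0x3c2f08c09afa0129, 10, 10,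
  0x48610edc48c85d6a, 0x48610edc48c87869, 10, 10, 10, 0x18eb97d456cf58ea, 10, 0xdf8cd80b76c1e6a,
  11, 0x47e90beb44000c69, 10, 11, 10, 10, 0x20213878a9a90c6a, 0x2021399294a92527,
  0xc4ef55ea503036a, 11, 11, 10, 10, 10, 10, 0x4860e4811c4a34ea, 11, 0x4860e4811c4a3729, 11, 10,
  11, 10, 9, 0x207cf18965c461ea, 0x3b4ac2dcc50983a9, 0x2dd6fdf66b3e2bea, 11, 10,
  0x171c977f106c132a, 10, 10, 10, 0x349f564449096aea, 0x303ee3c30c59bbe9, 9, 10,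
  0x3c9ed2305e60882a, 0x269bcdf255c4642a, 0x47cffa439e606d29, 0x48321a54a4843728,
  0x162d057264da9369, 0x20efcd2b5b0b83a7, 7, 0x459c190dad776d29, 8, 0x218a55b845c47cea,
  0xefecab4234a9369, 10, 0x484962848f0432aa, 10, 10, 11, 0x172bc568c80cb0a9, 10,
  0x3660548553068828, 0x4860eb1c962bbe2a, 10, 0x252f646cbd6597ea, 0x1db68a9be20bb9aa, 9,
  0x217feccc0cd5b0aa, 0x3c7728ebf47c5b29, 9, 0x3c9e680a9d09a329, 0x1d7266169255bbe9, 11, 9, 11, 9,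
  0x2f9c401a9d09b2e7, 0xf60fbe77f841328, 0x2c809afd16ec97e9, 0x134b1e20089aa56a,
  0x2dd6ff801f0b8ee9, 8, 9, 0x3aa20b9aba9b20aa, 0x20b24dbdaf84786a, 0x355d11eb8b7e71a9, 8,
  0x2837c4d2bf044029, 0x2befd74ee8d5666a, 9, 0x39c5842f3a0a85e9, 0x191fa2be7a85a329, 11,
  0x3fa9acde0b0b8829, 0x3290741d90d561ea, 0x31f9fc22e8d5ac2a, 9, 0x23788929fb8e9ea9,
  0x355eefb6347c7628, 0x3af22566347c7869, 11, 7, 8, 0x3576ac8dbe0a68aa, 0x35db28997bb78a69, 9, 10,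
  0x33b08f91660aae6a, 0x89266e92d780eaa, 0xa53f585733ba9ea, 0xa5e6bc0c72bb2ea, 11,
  0x22f6ca1a009e9c6a, 11, 0x33b08f92ebdab527, 0x408babcab6dc68aa, 10, 0x2fa2fe5dda09b76a, 10,
  0x3458e27e1b0ca32a, 10, 10, 0x4860e6f90628b52a, 0x479d5b66440c6f69, 9, 0x3aed560a6f2cbe29,
  0x2463cc0fff391c2a, 11, 0x27381e206f0b8a69, 0x1b96088a5c5cae6a, 11, 11, 9, 9,
  0x47c95e39ced03de9, 11, 11, 0x3b2069a4ced04269, 0x48321a54a48434e8, 0x2ec39d92d9d07ce9,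
  0x3aed60a159d061e7, 7, 9, 0x3456d342d9d06429, 9, 11, 9, 0x3aa4f9f8d90973e9, 0x207e078ceab8be29,
  0x389ab4eabd2d71a6, 0x3a9115d429098a68, 0x2f7e8e98d9098a69, 0x389ab4eabd2d71a7,
  0x389ab4eabd2d71a7, 7, 0x12ec4133273e2e2a, 11, 10, 0x34b44a8a09097f2a, 11, 10,
  0x476763f30909642a, 8, 0x476763f309097ce8, 10, 0x4855423b09095faa, 8, 0x34b415a8bf60666a, 11,
  0x415d3f1f090961ea, 10, 0x46e68b8c09097aaa, 11, 0x190d7b0c533e3dea, 0x1ae99fdc8f3e32aa, 11, 10,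
  10, 0x48557b798b6058ea, 11, 0x1e63daa11e50368, 0x36ae007310eb05aa, 11, 11, 10,
  0x62e950903cfae6a, 8, 11, 11, 9, 0x47c0c35bea099c69, 9, 0x16228563be9ebbe9, 0xcf157b299047f29,
  0xf74590c78ec19ea, 11, 0xfb3fc1d72441c29, 0x2c43c9df5bbb5faa, 10, 0x18a25f9e684e7f2a, 11,
  0x278692d8ab8f8166, 0x190df663233e522a, 11, 10, 0x2b4e55541129546a, 10, 11, 0x1ae9e24848acac27,
  0x20d69324168f9368, 0x8226f5089e38a6a, 10, 0x46b278816dd2a56a, 11, 0x1d51ed81cdc3b9aa, 8,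
  0x48611054a0cc9ea8, 10, 0x1141b8d43ceb0aa, 11, 0x275408624b3e56aa, 0x19d6d13cd253a0e8, 10,
  0x48611054a0ccb2e8, 0x393d1615f1c36aea, 8, 0x19b99327a770882a, 11, 10, 0x646e858f25ebbea, 11,
  0x409e6a6a6dd2a32a, 11, 0x486019a700cca9e6, 6, 0x35e0b744c0cc9c66, 0xcd764d5af0e97ea,
  0x40a6b738df79a326, 0x271d999b34eb8ee6, 0x3c1bdbdf0afd71a6, 0x271dd261a0475fa6, 6,
  0x386db3f65b4b8eea, 10, 0x389ef42de1258166, 11, 6, 0x48611054a0cca0ea, 11, 0x48611054a0cca7a6,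
  0x1913e59bd33095aa, 0x413178e2df799a28, 0xade624cf6b69eaa, 11, 0x190e1cdea4cc7cea, 11, 10,
  0x19390faba4cc7aaa, 11, 11, 10, 0x3979af96970f4028, 0x2307aa70a08c5d68, 11, 0x327e213b50ab0128,
  0x39092138f70f4da8, 8, 0x1cfa8c89954f7aaa, 0x39092175198f9128, 0x64e0970ba3e492a, 11, 10, 10,
  10, 0x2216a4d7be3e29aa, 11, 10, 11, 10, 11, 10, 0x9a7d3a0edb882a, 11, 0x4849cc86ba0997e9, 8, 9,
  0x163d4b84cad822ea, 11, 0x32be2d7b35e5132a, 11, 0x47377820fcc719e9, 10, 0x164a851cc6b80a2a,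
  0x1649c0b73ad817aa, 0x186af8f2550f85ea, 0x48611054a0cc95aa, 9, 0x48611054a0cc97e9,
  0x35b7ce4deebc156a, 0x1861865d6a3e426a, 11, 0x186c44a7adcf786a, 11, 10, 0x12ec6bef925e816a, 11,
  0x42b696d6ba09912a, 11, 10, 0x14475676235a6d2a, 0x3ca0cea3ddd2936a, 0x18763120f5f983aa,
  0x136e2c79b1844b69, 9, 0x195a96bbf865012a, 0x3cafd167521920a9, 0x4860e6eb7ad6396a, 11,
  0x4856fda87ad6402a, 11, 11, 0x4856fda87ad63baa, 10, 10, 9, 0x48325f257ab64b69, 11, 10, 11,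
  0x4860e6eb7ad64daa, 11, 0x429f29757ab644aa, 11, 9, 0x485e6c9abad65469, 0x485e6c9abad65469, 10,
  0x4860e6eb7ad64fea, 10, 0x4860e6eb7ad6522a, 0x485e2562bab656aa, 0x4860e6eb7ad646e9, 9,
  0x4860e6eb7ad6492a, 11, 0x4860e6eb7ad64b69, 0x48610e9086d6306a, 11, 10, 11, 10, 9,
  0x2dc04c466e507f29, 8, 11, 0x3caa4c32f75710ea, 0x2fc7421e2e50666a, 9, 0x397b290528d6b9a9,
  0x8d0a9f45e4807ea, 10, 0x20dba69128d68caa, 0x397b4c4288d66f6a, 0x124e8a81e48a1e69,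
  0x32beb30e3c020a2a, 11, 0x3b05212c68d67f29, 10, 0x40da5e1dd95044aa, 11, 0x41bd21cd08d65d6a,
  0x3635416b88c2b9aa, 11, 0x411e929fecf610e9, 11, 9, 0x48523167424e132a, 9, 0x3b3c0e9108c285e9,
  0x33665919fc33bbea, 11, 10, 0x139719863ff4666a, 11, 0x3cc38c7496c871aa, 11, 11,
  0x25394d5e2f394b6a, 0x4765d19f88c26aea, 10, 0x33665919fc33882a, 0x3365626ef8d6b0a7,
  0x35f3a8efbc33ac2a, 7, 0x3568023968d6ac27, 10, 0x367554c998d67aaa, 7, 0x32ef5859e8d68827,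
  0x2c916bf932d4642a, 11, 11, 10, 0x2dc03d80304858e7, 7, 7, 0xdf66657bc485d67, 0x1393854abc485fa7,
  11, 0x4860e6f896c88caa, 10, 0x41dfd30096c8bbea, 0x419bd28448c28eea, 11, 11, 10,
  0x39a5b60ed9100c67, 7, 0x22ab00379769012a, 11, 0x3b05212c68d68167, 0x48494f2c8114276a, 11, 10,
  0x3978aeb1cc336d2a, 11, 0xc4fdbdac13e44aa, 10, 0x1122cb7badb666a, 11, 0x64e0970ba3e4fea, 11, 10,
  0x20b1b11f433e276a, 11]

/-- Directions for adding all edges but the last. -/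
def searchData : List (List ℕ) :=
  [searchData0, searchData1, searchData2, searchData3, searchData4, searchData5, searchData6,
    searchData7, searchData8, searchData9, searchData10, searchData11, searchData12,
    searchData13, searchData14, searchData15, searchData16]

-- The verification of the whole search, with seventeen levels followed by the last edge. It yields
-- completeness of the list; that there are no repetitions is shown separately by the invariant.
set_option maxRecDepth 100000 in
theorem isCompleteSearch_representativeCodes :
    isCompleteSearch searchData searchData17 representativeCodes = true := by
  decide +kernel

/-! ### Obstructions and checks on the representatives -/

/-- Maps from the obstructions to the graphs number 21 to 83 that are subject to them. -/
def copyData : List ℕ := [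
  0x80ac8ece872, 0x80ac8ece872, 0x80ac8ece872, 0x80ac8ece872, 0x80ac8ece872, 0x80ac8ece872,
  0x80ac8ece872, 0x80ac8ece872, 0x80ac8ece872, 0x80ac8ece872, 0x80ac8ece872, 0x80ac8ece872,
  0x80ac8ece872, 0x80ac8ece872, 0x80ac8ece872, 0x80ac8ece872, 0x80ac8ece872, 0x80ac8ece872,
  0x8080c1c5da1, 0x68181f53492, 0x69005f89e61, 0x69005f89e61, 0x5d483353b52, 0x7f9a38559ac,
  0x69005f89e61, 0x69007edce6c, 0x73d06ad7d6c, 0x80ac453b0a1, 0x74b713d2c6c, 0x5d49ca8abe1,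
  0x7f9a38559ac, 0x80ac8375eb1, 0x80ac8375eb1, 0x2e1bca2de94, 0x65f8ae36116, 0x2e1bceb8ac2,
  0x80ac389dacb, 0x65f8aea0b3f, 0x65f8af00736, 0x39d255b9b17, 0x43bb9bf853d, 0x80a703bc40b,
  0x808094d4384, 0x80aaa82cfcc, 0x80aaa82cfcc, 0x660be42220a, 0x5154541f0d0, 0x80a90e59bcc,
  0x80829d1b8cc, 0x65120b710eb, 0x8095d59eccc, 0x8095d59eccc, 0x7fb088b0a21, 0x8095d59eccc,
  0x80829d1b8cc, 0x7fadc88ffe3, 0x169982e1eda, 0x1693fbffdda, 0x7c86965ac93, 0x68049bd91f8,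
  0x7d81a31d821, 0x37f17c2578b, 0x37f17241c42]

/-- The edges of the obstructions other than a bridge. -/
def Obstruction.edges : Obstruction → List (Fin 12 × Fin 12)
  | .bridge => []
  | .diamond => [(0, 1), (1, 2), (2, 3), (3, 0), (1, 3)]
  | .extendedBowtie => [(0, 1), (0, 2), (1, 2), (3, 4), (3, 5), (4, 5), (0, 6), (6, 3)]
  | .F1 => [(0, 1), (1, 2), (2, 3), (3, 0), (2, 4), (4, 5), (5, 6), (6, 0)]
  | .F2 => [(0, 1), (1, 2), (2, 3), (3, 4), (4, 5), (5, 6), (6, 7), (7, 0), (1, 3), (0, 4)]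
  | .F3 => [(0, 1), (1, 2), (2, 3), (3, 4), (4, 5), (5, 6), (6, 0), (0, 7), (7, 8), (2, 8), (5, 8)]
  | .F4 => [(0, 1), (1, 2), (2, 3), (3, 4), (4, 0), (5, 6), (5, 7), (6, 1), (6, 3), (7, 4)]
  | .tietze => [(0, 1), (1, 2), (2, 3), (3, 4), (4, 5), (5, 6), (6, 7), (7, 8), (8, 0), (0, 9),
      (3, 10), (6, 11), (9, 10), (10, 11), (11, 9), (1, 5), (2, 7), (4, 8)]

instance : DecidableRel diamond.Adj := by unfold diamond; infer_instance
instance : DecidableRel extendedBowtie.Adj := by unfold extendedBowtie; infer_instance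
instance : DecidableRel graphF1.Adj := by unfold graphF1; infer_instance
instance : DecidableRel graphF2.Adj := by unfold graphF2; infer_instance
instance : DecidableRel graphF3.Adj := by unfold graphF3; infer_instance
instance : DecidableRel graphF4.Adj := by unfold graphF4; infer_instance
instance : DecidableRel tietzeGraph.Adj := by unfold tietzeGraph; infer_instance
instance (k : Fin 17) : DecidableRel (balancedGraph k).Adj := by
  unfold balancedGraph lcfGraph; infer_instance

theorem tietzeGraph_isContained_iff {G : SimpleGraph (Fin 12)} :
    tietzeGraph.IsContained G ↔ ContainsCopy G Obstruction.tietze.edges :=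
  isContained_iff_containsCopy le_rfl (by decide +kernel) (by decide +kernel)

theorem Obstruction.holds_iff_containsCopy {G : SimpleGraph (Fin 12)} {o : Obstruction}
    (h1 : o ≠ .bridge) (h2 : o ≠ .tietze) : o.Holds G ↔ ContainsCopy G o.edges := by
  cases o
  case bridge => exact absurd rfl h1
  case tietze => exact absurd rfl h2
  all_goals
    exact isContained_iff_containsCopy (by norm_num) (by decide +kernel) (by decide +kernel)

theorem hasRainbowColoring_edges {o : Obstruction} (h : o ≠ .bridge) :
    hasRainbowColoring (edgesCode o.edges) = false := by
  cases o
  case bridge => exact absurd rfl h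
  all_goals decide +kernel

theorem Obstruction.Holds.not_isThreeBalanced {G : SimpleGraph (Fin 12)} (hG : IsCubic G)
    {o : Obstruction} (h : o ≠ .bridge) (ho : o.Holds G) : ¬ IsThreeBalanced G := by
  refine not_isThreeBalanced_of_containsCopy hG (hasRainbowColoring_edges h) ?_
  by_cases h2 : o = .tietze
  · subst h2
    obtain ⟨e⟩ := ho
    exact tietzeGraph_isContained_iff.1 e.isContained'
  · exact (holds_iff_containsCopy h h2).1 ho

/-- The adjacency matrix number `k` in the list of representatives. -/
def representativeCode (k : ℕ) : ℕ := representativeCodes.getD k 0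

/-- The obstruction assigned to the representative number `k`, for `17 ≤ k`. -/
def assignedObstruction (k : ℕ) : Obstruction :=
  if k < 21 then .bridge
  else if k < 39 then .diamond
  else if k < 52 then .extendedBowtie
  else if k < 76 then .F1
  else if k < 77 then .F2
  else if k < 82 then .F3
  else if k < 84 then .F4
  else .tietze

theorem isCubicCode_representativeCode :
    ∀ k : Fin 85, isCubicCode (representativeCode k) = true := by
  decide +kernel

theorem reachSet_representativeCode :
    ∀ k : Fin 85, reachSet (representativeCode k) 11 1 = 4095 := by
  decide +kernel

theorem isBridgeless_representativeCode :
    ∀ k : Fin 17, isBridgeless (representativeCode k) = true := by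
  decide +kernel

/-- In these four codes the bridge joins 4 to 5, and the mask 31 is its side consisting of the
vertices 0 to 4. -/
theorem isBridgeCut_representativeCode :
    ∀ k : Fin 4, isBridgeCut (representativeCode (17 + k)) 31 4 5 = true := by
  decide +kernel

/-- A bridge has no excluded subgraph assigned to it, so these four graphs are themselves searched
for colorings. -/
theorem hasRainbowColoring_representativeCode :
    ∀ k : Fin 4, hasRainbowColoring (edgesCode (codeEdges (representativeCode (17 + k)))) = false := by
  decide +kernel

theorem isEmbedding_representativeCode :
    ∀ k : Fin 63, isEmbedding (assignedObstruction (21 + k)).edges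
      (edgesCode (codeEdges (representativeCode (21 + k)))) (copyData.getD k 0) = true := by
  decide +kernel

/-- The codes of the first 17 representatives use the vertex labels of the LCF graphs, so the listed
colorings apply to them unchanged. -/
theorem balancedGraph_adj_iff : ∀ (k : Fin 17) (i j : Fin 12), (balancedGraph k).Adj i j ↔
    adjBit (representativeCode k) i j = true := by
  decide +kernel

theorem tietzeGraph_adj_iff : ∀ i j : Fin 12, tietzeGraph.Adj i j ↔
    adjBit (representativeCode 84) i j = true := by
  decide +kernel

theorem isBridgeless_tietze : isBridgeless (representativeCode 84) = true := by
  decide +kernel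

set_option maxRecDepth 100000 in
theorem nodup_codeInvariant : (representativeCodes.map codeInvariant).Nodup := by
  decide +kernel

theorem hasCopy_tietze {o : Obstruction} (h1 : o ≠ .bridge) (h2 : o ≠ .tietze) :
    hasCopy (edgesCode o.edges) (representativeCode 84) = false := by
  cases o
  case bridge => exact absurd rfl h1
  case tietze => exact absurd rfl h2
  all_goals decide +kernel

theorem countP_listedColoring : ∀ (k : Fin 17) (v : Fin 12) (i : ZMod 3),
    vertexList.countP (fun w => adjBit (representativeCode k) v w &&
      decide (listedColoring k w = i)) = 1 := by
  -- This exposes `ZMod 3` as `Fin 3`, so that the quantifier over the colors can be decided by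
  -- enumeration.
  unfold ZMod
  decide +kernel

theorem isBalancedColoring_listedColoring (k : Fin 17) :
    IsBalancedColoring (balancedGraph k) (listedColoring k) := by
  have key : ∀ v i, ((balancedGraph k).neighborSet v ∩ listedColoring k ⁻¹' {i}).ncard = 1 := by
    intro v i
    rw [← countP_listedColoring k v i, countP_vertexList, ← Set.ncard_coe_finset]
    congr 1
    ext w
    simp [balancedGraph_adj_iff]
  intro v i j
  rw [key, key]

/-! ### The chromatic index of Tietze's graph -/

/-- Whether the edges in a list, given by their ends, have a proper coloring with three colors. -/
def hasEdgeColoring (es : List (Fin 12 × Fin 12)) : Bool :=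
  isSolvable [(0 : Fin 3), 1, 2] (fun d e x y => !decide (x = y) ||
    !(decide (d.1 = e.1) || decide (d.1 = e.2) || decide (d.2 = e.1) || decide (d.2 = e.2))) es []

theorem not_colorable_lineGraph {G : SimpleGraph (Fin 12)} {es : List (Fin 12 × Fin 12)}
    (hes : ∀ e ∈ es, G.Adj e.1 e.2) (hnd : (es.map fun e => s(e.1, e.2)).Nodup)
    (h : hasEdgeColoring es = false) : ¬ G.lineGraph.Colorable 3 := by
  classical
  rintro ⟨C⟩
  refine Bool.false_ne_true (h.symm.trans ?_)
  refine isSolvable_of_pairwise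
    (fun e => if he : G.Adj e.1 e.2 then C ⟨s(e.1, e.2), he⟩ else 0) (fun e => ?_) ?_ (by simp)
  · have h3 : ∀ c : Fin 3, c ∈ [0, 1, 2] := by decide
    exact h3 _
  · refine (List.pairwise_map.1 hnd).imp_of_mem fun {d e} hd he hde => ?_
    rw [dif_pos (hes d hd), dif_pos (hes e he), Bool.or_eq_true, Bool.not_eq_true',
      decide_eq_false_iff_not, Bool.not_eq_true', ← Bool.not_eq_true, ← imp_iff_not_or]
    intro hc hs
    simp only [Bool.or_eq_true, decide_eq_true_eq] at hs
    refine C.valid (v := ⟨s(d.1, d.2), hes d hd⟩) (w := ⟨s(e.1, e.2), hes e he⟩) ?_ hc.symm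
    refine ⟨fun h => hde (congrArg Subtype.val h), ?_⟩
    rcases hs with ((h | h) | h) | h
    · exact ⟨d.1, by simp, by simp [← h]⟩
    · exact ⟨d.2, by simp, by simp [← h]⟩
    · exact ⟨d.1, by simp, by simp [← h]⟩
    · exact ⟨d.2, by simp, by simp [← h]⟩

/-- An edge coloring of Tietze's graph with four colors. -/
def tietzeEdgeColor (e : Sym2 (Fin 12)) : Fin 4 :=
  if e ∈ [s(0, 1), s(2, 3), s(4, 5), s(6, 7), s(9, 10)] then 0
  else if e ∈ [s(1, 2), s(3, 4), s(5, 6), s(7, 8), s(0, 9), s(10, 11)] then 1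
  else if e ∈ [s(8, 0), s(3, 10), s(6, 11), s(1, 5), s(2, 7)] then 2
  else 3

theorem tietzeEdgeColor_ne : ∀ a b c : Fin 12, tietzeGraph.Adj a b → tietzeGraph.Adj a c → b ≠ c →
    tietzeEdgeColor s(a, b) ≠ tietzeEdgeColor s(a, c) := by
  decide +kernel

theorem chromaticIndex_tietzeGraph : chromaticIndex tietzeGraph = 4 := by
  refine SimpleGraph.chromaticNumber_eq_iff_colorable_not_colorable.2 ⟨⟨.mk
    (fun e => tietzeEdgeColor e.1) ?_⟩, not_colorable_lineGraph (es := Obstruction.tietze.edges)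
      (by decide +kernel) (by decide +kernel) (by decide +kernel)⟩
  rintro ⟨d, hd⟩ ⟨e, he⟩ ⟨hne, a, had, hae⟩
  obtain ⟨b, rfl⟩ := Sym2.mem_iff_exists.1 had
  obtain ⟨c, rfl⟩ := Sym2.mem_iff_exists.1 hae
  exact tietzeEdgeColor_ne a b c hd he fun h => hne (by simp [h])

/-! ### The classification -/

theorem balancedGraph_eq (k : Fin 17) : balancedGraph k = codeGraph (representativeCode k) := by
  ext i j
  exact (balancedGraph_adj_iff k i j).trans
    (codeGraph_adj (isCubicCode_representativeCode (k.castLE (by norm_num)))).symm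

theorem tietzeGraph_eq : tietzeGraph = codeGraph (representativeCode 84) := by
  ext i j
  exact (tietzeGraph_adj_iff i j).trans (codeGraph_adj (isCubicCode_representativeCode 84)).symm

/-- The connected cubic graph number `k`. -/
def representative (k : Fin 85) : CubicTwelve :=
  ⟨codeGraph (representativeCode k),
    connected_codeGraph (isCubicCode_representativeCode k) (reachSet_representativeCode k),
    isCubic_codeGraph (isCubicCode_representativeCode k)⟩

theorem length_representativeCodes : representativeCodes.length = 85 := by decide +kernel

theorem exists_iso_representative (G : CubicTwelve) :
    ∃ k, Nonempty (G.1 ≃g (representative k).1) := by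
  obtain ⟨n, hn, hG⟩ := exists_containsCopy_of_isCompleteSearch
    isCompleteSearch_representativeCodes G.1 G.2.1 G.2.2
  obtain ⟨k, hk, rfl⟩ := List.mem_iff_getElem.1 hn
  have h : representativeCodes[k] = representativeCode k := (List.getD_eq_getElem _ 0 hk).symm
  rw [h] at hG
  rw [length_representativeCodes] at hk
  exact ⟨⟨k, hk⟩,
    nonempty_iso_of_containsCopy (isCubicCode_representativeCode ⟨k, hk⟩) G.2.2 hG⟩

theorem List.Nodup.eq_of_getD_eq {α : Type*} {f : ℕ → α} {l : List ℕ} (h : (l.map f).Nodup)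
    {i j d : ℕ} (hi : i < l.length) (hj : j < l.length) (hij : f (l.getD i d) = f (l.getD j d)) :
    i = j := by
  rw [List.getD_eq_getElem _ _ hi, List.getD_eq_getElem _ _ hj] at hij
  refine (h.getElem_inj_iff (hi := by simpa) (hj := by simpa)).1 ?_
  simpa using hij

theorem representative_injective {k l : Fin 85}
    (h : Nonempty ((representative k).1 ≃g (representative l).1)) : k = l := by
  obtain ⟨e⟩ := h
  have h := cubicInvariant_congr e
  rw [representative, representative, cubicInvariant_codeGraph (isCubicCode_representativeCode k),
    cubicInvariant_codeGraph (isCubicCode_representativeCode l)] at h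
  refine Fin.ext (nodup_codeInvariant.eq_of_getD_eq (d := 0) ?_ ?_ h)
  · rw [length_representativeCodes]; exact k.isLt
  · rw [length_representativeCodes]; exact l.isLt

theorem isThreeBalanced_representative {k : Fin 85} (hk : k.val < 17) :
    IsThreeBalanced (representative k).1 := by
  refine ⟨listedColoring ⟨k, hk⟩, ?_⟩
  have h := isBalancedColoring_listedColoring ⟨k, hk⟩
  rwa [balancedGraph_eq] at h

theorem containsCopy_codeEdges {n : ℕ} (hn : isCubicCode n = true) :
    ContainsCopy (codeGraph n) (codeEdges n) :=
  ⟨id, Function.injective_id, fun _ he => (codeGraph_adj hn).2 (mem_codeEdges.1 he).2⟩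

theorem holds_assignedObstruction {k : Fin 85} (hk : 17 ≤ k.val) :
    (assignedObstruction k).Holds (representative k).1 := by
  have hcub := isCubicCode_representativeCode k
  rcases lt_or_ge k.val 21 with h | h
  · obtain ⟨i, hi⟩ := Nat.exists_eq_add_of_le hk
    have hcut := isBridgeCut_representativeCode ⟨i, by omega⟩
    have ho : assignedObstruction k = .bridge := by rw [assignedObstruction, if_pos h]
    rw [ho]
    refine hasBridge_codeGraph hcub (m := 31) (u := 4) (v := 5) ?_
    rw [hi]
    exact hcut
  rcases lt_or_ge k.val 84 with h' | h'
  · obtain ⟨i, hi⟩ := Nat.exists_eq_add_of_le h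
    have hemb := isEmbedding_representativeCode ⟨i, by omega⟩
    have ho : ∀ k < 84, 21 ≤ k →
        assignedObstruction k ≠ .bridge ∧ assignedObstruction k ≠ .tietze := by
      intro k h1 h2
      unfold assignedObstruction
      split_ifs <;> first | omega | simp
    obtain ⟨h1, h2⟩ := ho k h' h
    refine (Obstruction.holds_iff_containsCopy h1 h2).2 ?_
    have hcopy := containsCopy_codeEdges hcub
    rw [hi] at hcopy
    have := hcopy.of_isEmbedding hemb
    rw [← hi] at this
    exact this
  · have hk : k = 84 := Fin.ext (show k.val = 84 by omega)
    subst hk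
    exact ⟨by rw [tietzeGraph_eq]; exact SimpleGraph.Iso.refl⟩

theorem not_isThreeBalanced_representative {k : Fin 85} (hk : 17 ≤ k.val) :
    ¬ IsThreeBalanced (representative k).1 := by
  by_cases h : k.val < 21
  · obtain ⟨i, hi⟩ := Nat.exists_eq_add_of_le hk
    refine not_isThreeBalanced_of_containsCopy (representative k).2.2
      (es := codeEdges (representativeCode k)) ?_
      (containsCopy_codeEdges (isCubicCode_representativeCode k))
    rw [hi]
    exact hasRainbowColoring_representativeCode ⟨i, by omega⟩
  · refine (holds_assignedObstruction hk).not_isThreeBalanced (representative k).2.2 ?_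
    unfold assignedObstruction
    rw [if_neg h]
    split_ifs <;> simp

theorem isThreeBalanced_representative_iff {k : Fin 85} :
    IsThreeBalanced (representative k).1 ↔ k.val < 17 :=
  ⟨fun h => not_le.1 fun hk => not_isThreeBalanced_representative hk h,
    isThreeBalanced_representative⟩

/-- A bridge is excluded through the classification: a balanced graph is isomorphic to one of the
first 17 representatives, and these are bridgeless. The other obstructions need no connectedness. -/
theorem Obstruction.Holds.not_isThreeBalanced_of_connected {G : SimpleGraph (Fin 12)}
    (hconn : G.Connected) (hG : IsCubic G) {o : Obstruction} (ho : o.Holds G) :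
    ¬ IsThreeBalanced G := by
  by_cases h : o = .bridge
  · subst h
    intro hb
    obtain ⟨k, ⟨e⟩⟩ := exists_iso_representative ⟨G, hconn, hG⟩
    have hk := isThreeBalanced_representative_iff.1 (hb.of_iso e)
    exact not_hasBridge_codeGraph (isCubicCode_representativeCode k)
      (isBridgeless_representativeCode ⟨k, hk⟩) (HasBridge.of_iso e ho)
  · exact ho.not_isThreeBalanced hG h

theorem eq_tietze_of_holds_tietzeGraph {o : Obstruction} (ho : o.Holds tietzeGraph) :
    o = .tietze := by
  by_contra h2
  have hcub := isCubicCode_representativeCode 84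
  rw [tietzeGraph_eq] at ho
  by_cases h1 : o = .bridge
  · subst h1
    exact not_hasBridge_codeGraph hcub isBridgeless_tietze ho
  · exact not_containsCopy_codeGraph hcub (hasCopy_tietze h1 h2)
      ((Obstruction.holds_iff_containsCopy h1 h2).1 ho)

theorem toClass_eq_iff {G H : CubicTwelve} : G.toClass = H.toClass ↔ Nonempty (G.1 ≃g H.1) :=
  Quotient.eq (r := cubicTwelveSetoid)

/-! ### Counting isomorphism classes -/

/-- The numbering of the isomorphism classes of connected cubic graphs on 12 vertices. -/
noncomputable def classEquiv : Fin 85 ≃ CubicTwelveClass :=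
  Equiv.ofBijective (fun k => (representative k).toClass)
    ⟨fun _ _ h => representative_injective (toClass_eq_iff.1 h), fun c => by
      obtain ⟨G, rfl⟩ := Quotient.exists_rep c
      obtain ⟨k, ⟨e⟩⟩ := exists_iso_representative G
      exact ⟨k, toClass_eq_iff.2 ⟨e.symm⟩⟩⟩

theorem toClass_eq_classEquiv_iff {G : CubicTwelve} {k : Fin 85} :
    G.toClass = classEquiv k ↔ Nonempty (G.1 ≃g (representative k).1) :=
  toClass_eq_iff

theorem exists_isThreeBalanced_iff {k : Fin 85} :
    (∃ G : CubicTwelve, G.toClass = classEquiv k ∧ IsThreeBalanced G.1) ↔ k.val < 17 := by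
  constructor
  · rintro ⟨G, hG, hb⟩
    obtain ⟨e⟩ := toClass_eq_classEquiv_iff.1 hG
    exact isThreeBalanced_representative_iff.1 (hb.of_iso e)
  · exact fun hk => ⟨representative k, rfl, isThreeBalanced_representative hk⟩

/-- The obstruction assigned to the isomorphism class of a graph that is not 3-balanced. -/
noncomputable def classObstruction
    (c : {c : CubicTwelveClass // ¬ ∃ G : CubicTwelve, G.toClass = c ∧ IsThreeBalanced G.1}) :
    Obstruction :=
  assignedObstruction (classEquiv.symm c.1)

/-- The classes that are not 3-balanced correspond under `classEquiv` to the indices from 17 on,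
which turns the multiplicities into decidable counts in `Fin 85`. -/
theorem ncard_classObstruction (o : Obstruction) : {c | classObstruction c = o}.ncard =
    {k : Fin 85 | 17 ≤ k.val ∧ assignedObstruction k = o}.ncard := by
  rw [← Set.ncard_image_of_injective _ (classEquiv.symm.injective.comp Subtype.val_injective)]
  congr 1
  ext k
  constructor
  · rintro ⟨c, hc, rfl⟩
    refine ⟨not_lt.1 fun h => c.2 ?_, hc⟩
    have h2 := exists_isThreeBalanced_iff.2 h
    rwa [Function.comp_apply, Equiv.apply_symm_apply] at h2
  · rintro ⟨hk, ho⟩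
    refine ⟨⟨classEquiv k, fun h => not_lt.2 hk (exists_isThreeBalanced_iff.1 h)⟩, ?_, by simp⟩
    rw [Set.mem_ofPred_eq, classObstruction, Equiv.symm_apply_apply]
    exact ho

instance : DecidableEq Obstruction := fun o o' =>
  decidable_of_iff (o.ctorIdx = o'.ctorIdx) (by cases o <;> cases o' <;> simp [Obstruction.ctorIdx])

theorem ncard_classObstruction_eq_card (o : Obstruction) : {c | classObstruction c = o}.ncard =
    (Finset.univ.filter fun k : Fin 85 => 17 ≤ k.val ∧ assignedObstruction k = o).card := by
  rw [ncard_classObstruction, ← Set.ncard_coe_finset]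
  simp

theorem holds_classObstruction (c) (G : CubicTwelve) (hG : G.toClass = c.1) :
    (classObstruction c).Holds G.1 := by
  obtain ⟨c, hc⟩ := c
  obtain ⟨k, rfl⟩ := classEquiv.surjective c
  rw [classObstruction, Equiv.symm_apply_apply]
  obtain ⟨e⟩ := toClass_eq_classEquiv_iff.1 hG
  exact (holds_assignedObstruction (not_lt.1 fun h => hc (exists_isThreeBalanced_iff.2 h))).of_iso
    e.symm

theorem mainTheorem8 :
    -- the two counts, up to isomorphism
    Nat.card CubicTwelveClass = 85 ∧
    {c : CubicTwelveClass | ∃ G : CubicTwelve, G.toClass = c ∧ IsThreeBalanced G.1}.ncard = 17 ∧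
    -- the list of the 3-balanced graphs, with explicit colorings
    (∀ k : Fin 17, (balancedGraph k).Connected ∧ IsCubic (balancedGraph k) ∧
      IsBalancedColoring (balancedGraph k) (listedColoring k)) ∧
    (∀ k l : Fin 17, Nonempty (balancedGraph k ≃g balancedGraph l) → k = l) ∧
    (∀ G : SimpleGraph (Fin 12), G.Connected → IsCubic G → IsThreeBalanced G →
      ∃ k : Fin 17, Nonempty (G ≃g balancedGraph k)) ∧
    -- the graphs that are not 3-balanced are exactly those with an obstruction
    (∀ G : SimpleGraph (Fin 12), G.Connected → IsCubic G →
      (¬ IsThreeBalanced G ↔ ∃ o : Obstruction, o.Holds G)) ∧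
    -- Tietze's graph is subject to none of the other obstructions and has chromatic index 4
    (tietzeGraph.Connected ∧ IsCubic tietzeGraph ∧
      (∀ o : Obstruction, o.Holds tietzeGraph → o = Obstruction.tietze) ∧
      chromaticIndex tietzeGraph = 4) ∧
    -- each of the 68 other graphs can be assigned one of its obstructions, with these multiplicities
    (∃ r : {c : CubicTwelveClass // ¬ ∃ G : CubicTwelve, G.toClass = c ∧ IsThreeBalanced G.1} →
        Obstruction,
      (∀ c, ∀ G : CubicTwelve, G.toClass = c.1 → (r c).Holds G.1) ∧
      {c | r c = .bridge}.ncard = 4 ∧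
      {c | r c = .diamond}.ncard = 18 ∧
      {c | r c = .extendedBowtie}.ncard = 13 ∧
      {c | r c = .F1}.ncard = 24 ∧
      {c | r c = .F2}.ncard = 1 ∧
      {c | r c = .F3}.ncard = 5 ∧
      {c | r c = .F4}.ncard = 2 ∧
      {c | r c = .tietze}.ncard = 1) := by
  refine ⟨?_, ?_, fun k => ⟨?_, ?_, isBalancedColoring_listedColoring k⟩, fun k l h => ?_,
    fun G hconn hG hb => ?_, fun G hconn hG => ⟨fun hb => ?_, ?_⟩,
    ⟨?_, ?_, fun o => eq_tietze_of_holds_tietzeGraph, chromaticIndex_tietzeGraph⟩,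
    classObstruction, holds_classObstruction, ?_⟩
  · rw [← Nat.card_congr classEquiv, Nat.card_eq_fintype_card, Fintype.card_fin]
  · have h : {c : CubicTwelveClass | ∃ G : CubicTwelve, G.toClass = c ∧ IsThreeBalanced G.1} =
        classEquiv '' ((Finset.univ.filter fun k : Fin 85 => k.val < 17 : Finset (Fin 85)) :
          Set (Fin 85)) := by
      ext c
      obtain ⟨k, rfl⟩ := classEquiv.surjective c
      rw [Set.mem_ofPred_eq, exists_isThreeBalanced_iff, classEquiv.injective.mem_set_image]
      simp
    rw [h, Set.ncard_image_of_injective _ classEquiv.injective, Set.ncard_coe_finset]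
    decide +kernel
  · rw [balancedGraph_eq]
    exact (representative (k.castLE (by norm_num))).2.1
  · rw [balancedGraph_eq]
    exact (representative (k.castLE (by norm_num))).2.2
  · rw [balancedGraph_eq, balancedGraph_eq] at h
    exact Fin.castLE_injective (by norm_num) (representative_injective
      (k := k.castLE (by norm_num)) (l := l.castLE (by norm_num)) h)
  · obtain ⟨k, ⟨e⟩⟩ := exists_iso_representative ⟨G, hconn, hG⟩
    have hk := isThreeBalanced_representative_iff.1 (hb.of_iso e)
    refine ⟨⟨k, hk⟩, ?_⟩
    rw [balancedGraph_eq]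
    exact ⟨e⟩
  · obtain ⟨k, ⟨e⟩⟩ := exists_iso_representative ⟨G, hconn, hG⟩
    -- An index below 17 would make `G` balanced, so the obstruction assigned to its representative
    -- is available and carries over to `G`.
    exact ⟨_, (holds_assignedObstruction (not_lt.1 fun hk =>
      hb ((isThreeBalanced_representative hk).of_iso e.symm))).of_iso e.symm⟩
  · rintro ⟨o, ho⟩
    exact ho.not_isThreeBalanced_of_connected hconn hG
  · rw [tietzeGraph_eq]
    exact (representative 84).2.1
  · rw [tietzeGraph_eq]
    exact (representative 84).2.2
  · simp only [ncard_classObstruction_eq_card]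
    decide +kernel
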